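/- **Setting.** Let $1<K<\infty$, let $\mathcal X\subset\mathbb R$ be compact with positive Lebesgue measure, and let $x_1,x_2,\ldots\in\mathcal X$, $X_n=(x_1,\ldots,x_n)$. The data are real responses $Y_{nm}=(y_{ij})_{i\le n,\,j\le m}$, with densities with respect to a common $\sigma$-finite measure. Under model $\mathcal M_k$ ($k=1,\ldots,K$) with parameter $\theta_k\in\Theta_k$ the $m$ replicates are independent and $y_{ij}\sim f_k(\cdot\mid\theta_k,x_i,y_{1j},\ldots,y_{i-1,j})$; the prior $\pi_k$ of $\theta_k$ has an everywhere positive density with respect to a $\sigma$-finite measure. The true model $\mathcal M_0$ has the same form, with a prior on $\Theta_0$ that may be a point mass, and the data follow its marginal law. The model index $\zeta$ satisfies $P(\zeta=k\mid p_1,\ldots,p_K)=p_k$, where $(p_1,\ldots,p_K)$ has a prior on the simplex with $E(p_k)>0$ for every $k$. **Conditions.** Let $R_n(\theta)$ be the likelihood ratio of $\mathcal M_k$ at $\theta$ to the marginal density of $Y_{nm}$ under $\mathcal M_0$, and let $h_k(A)$ be the $\pi_k$-essential infimum over $A$ of the rate $h_k$ below. For every $m>1$, each $\mathcal M_k$ satisfies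 Shalizi's conditions: - (S1) $R_n(\theta)$ is jointly measurable. - (S2) $h_k(\theta)=\lim_n n^{-1}E\log(1/R_n(\theta))\in[0,\infty]$ exists and is measurable. - (S3) $n^{-1}\log R_n(\theta)\to-h_k(\theta)$ a.s. for each $\theta$. - (S4) $\pi_k(I)<1$, where $I=\{h_k=\infty\}$. - (S5) There are measurable $\mathcal G_n\to\Theta_k$ with $\pi_k(\mathcal G_n)\ge 1-z e^{-\gamma n}$ for some $z>0$, $\gamma>2h_k(\Theta_k)$; a.s., the convergence in (S3) is uniform over $\mathcal G_n\setminus I$, and $n^{-1}\log R_n\to-\infty$ uniformly over $\mathcal G_n\cap I$ up to $\pi_k$-null sets (no condition if $\pi_k(I)=0$); and $h_k(\mathcal G_n)\to h_k(\Theta_k)$. - (S6) For every $\delta>0$, a.s. for all large $n$, $\frac1{n'}\log\int_{\mathcal G_n}R_{n'}\,d\pi_k\le\delta+\limsup_l\frac1l\log\int_{\mathcal G_n}R_l\,d\pi_k$ for all $n'\ge n$. - (S7) $h_k(\mathcal G_n\cap A)\to h_k(A)$ whenever $\pi_k(A)>0$. There is a unique $\tilde k$ (the same for all $m>1$) with $h_{\tilde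 k}(\Theta_{\tilde k})<h_k(\Theta_k)$ for all $k\ne\tilde k$, and measurable regions $\tilde\Theta_k\subseteq\Theta_k$ with $h_k(\tilde\Theta_k^c)>h_k(\Theta_k)$ for every $m>1$. **Hypotheses tested.** Let $\theta_k=(\eta,\xi)$ include a regression function $\eta$, let $H$ be a given transformation, $c_0\ge1$, $\bar y_i$ and $s_i$ the sample mean and standard deviation of $y_{i1},\ldots,y_{im}$, and let $\tilde x_i$ have the uniform prior on $B_{im}(\theta_k)=\{x\in\mathcal X:\,|H(\eta(x))-\bar y_i|\le c_0s_i/\sqrt m\}$. Let $\pi(\tilde x_i\mid X_{n,-i},Y_{nm},\mathcal M_k,\tilde\Theta_k)$ be the resulting cross-validation posterior (with $x_i$ treated as unknown) restricted to $\theta_k\in\tilde\Theta_k$ (taken uniform on $\mathcal X$ if its normalising constant is $0$ or $\infty$), with mean $E_i$ and variance $V_i$. For $c>0$ let $T^{(k)}(v)=\frac1n\sum_{i\le n}|v_i-E_i|/\sqrt{V_i+c}$ or $T^{(k)}(v)=\frac1n\sum_{i\le n}(v_i-E_i)^2/(V_i+c)$. Given the data, $\mathcal M_k$ and $\tilde\Theta_k$,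 let $\tilde X_n=(\tilde x_1,\ldots,\tilde x_n)$ have independent components with these posteriors, let $[\tilde\ell_{knm},\tilde u_{knm}]$ be a $100(1-\alpha_0)\%$ credible interval (measurable in the data, of posterior probability at least $1-\alpha_0$) for $T^{(k)}(\tilde X_n)$, $0<\alpha_0<1$, and let $a_k=\lim_{m}\lim_{n}T^{(k)}(X_n)$ a.s. For $\varepsilon>0$ test $$H_{0k}:\ \zeta=k,\ \theta_k\in\tilde\Theta_k,\ T^{(k)}(\tilde X_n)-T^{(k)}(X_n)\in[\tilde\ell_{knm}-a_k-\varepsilon,\ \tilde u_{knm}-a_k+\varepsilon]$$ against its complement $H_{1k}$. Let $v_{knm}$ be the posterior probability of $H_{1k}$; reject $H_{0k}$ ($\hat d_k=1$) iff $v_{knm}>\beta_{nm}$, and $\hat d_k=0$ otherwise, where $0<\beta_{nm}<1$. Put $$cFDR_{nm}=\frac{\sum_k\hat d_k(1-v_{knm})}{\left(\sum_k\hat d_k\right)\vee1},\qquad pBFDR_{nm}=E(cFDR_{nm}).$$ Throughout, $\lim_m\lim_n u_{nm}=L$ means $\lim_m\limsup_n|u_{nm}-L|=0$, and "for sufficiently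 large $m,n$" means: for all large $m$ and then all large $n$ (depending on $m$ and on the realisation of the data). **Theorem.** Under these conditions: 1. There are (nonrandom) $\beta_{nm}\in(0,1)$ with $\beta_{nm}\to0$ as $m,n\to\infty$ such that $\lim_m\lim_n cFDR_{nm}=1/K$ a.s. and $\lim_m\lim_n pBFDR_{nm}=1/K$. 2. For any nonrandom sequence $\beta_{nm}\in(0,1)$: (a) if a.s. $\hat d_{\tilde k}=1$ for sufficiently large $m,n$, then $\lim_m\lim_n\beta_{nm}=0$, and $\lim_m\lim_n cFDR_{nm}=1/K$ a.s., $\lim_m\lim_n pBFDR_{nm}=1/K$; (b) if a.s. $\hat d_{\tilde k}=0$ for sufficiently large $m,n$, then $\lim_m\lim_n cFDR_{nm}=0$ a.s. and $\lim_m\lim_n pBFDR_{nm}=0$; (c) if $\lim_m\lim_n cFDR_{nm}=L$ a.s. for a constant $L$, then $L\in\{0,1/K\}$ and $\lim_m\lim_n pBFDR_{nm}=L$. Thus $1/K$ is the only nonzero asymptotic level. -/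

import Mathlib

open MeasureTheory Filter Topology
open scoped ENNReal NNReal

universe u v w

noncomputable section

namespace InverseTest

/-- `lim_{m → ∞} lim_{n → ∞} u n m = L`: for large `m`, `u n m` is close to `L` for all large `n`,
where "large `n`" may depend on `m`
(equivalently `lim_m limsup_n |u n m - L| = 0`, no inner limit being required to exist). -/
def IterLim (s : ℕ → ℕ → ℝ) (L : ℝ) : Prop :=
  ∀ δ > 0, ∀ᶠ m in atTop, ∀ᶠ n in atTop, |s n m - L| < δ

/-- A data set `Y_{nm} = (y_{ij})`, `i` over the `n` covariate values and `j` over the `m`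
replicates. -/
abbrev Data (n m : ℕ) := Fin n → Fin m → ℝ

/-- The `(n × m)`-fold product of the reference measure on the response space. -/
def refMeasure (lam : Measure ℝ) (n m : ℕ) : Measure (Data n m) :=
  Measure.pi fun _ => Measure.pi fun _ => lam

/-- A Bayesian response model with densities with respect to `lam`: `dens i θ x past` is the
conditional density of the `i`-th response of a replicate, given the parameter `θ`, the covariate
value `x`, and the previous responses `past` of that replicate. -/
structure ResponseModel (lam : Measure ℝ) (X : Set ℝ) (Θ : Type*) [MeasurableSpace Θ] where
  dens : (i : ℕ) → Θ → ℝ → (Fin i → ℝ) → ℝ → ℝ≥0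
  measurable_dens : ∀ i, Measurable
    fun q : Θ × ℝ × (Fin i → ℝ) × ℝ => dens i q.1 q.2.1 q.2.2.1 q.2.2.2
  lintegral_dens : ∀ i θ, ∀ x ∈ X, ∀ past, ∫⁻ y, (dens i θ x past y : ℝ≥0∞) ∂lam = 1
  prior : Measure Θ
  isProbabilityMeasure_prior : IsProbabilityMeasure prior

namespace ResponseModel

variable {lam : Measure ℝ} {X : Set ℝ} {Θ : Type*} [MeasurableSpace Θ]

/-- The likelihood `f(Y_{nm} | X_n, θ)`; the `m` replicates are independent given `θ`. -/
def likelihood (M : ResponseModel lam X Θ) {n m : ℕ} (x : Fin n → ℝ) (θ : Θ) (D : Data n m) :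
    ℝ≥0∞ :=
  ∏ i : Fin n, ∏ j : Fin m,
    (M.dens i θ (x i) (fun l : Fin i => D ⟨l, l.isLt.trans i.isLt⟩ j) (D i j) : ℝ≥0∞)

/-- The marginal density `∫ f(Y_{nm} | X_n, θ) dπ(θ)`. -/
def marginal (M : ResponseModel lam X Θ) {n m : ℕ} (x : Fin n → ℝ) (D : Data n m) : ℝ≥0∞ :=
  ∫⁻ θ, M.likelihood x θ D ∂M.prior

end ResponseModel

/-- A competing model: a response model whose prior has an everywhere positive density with respect
to a σ-finite measure, together with the regression function `η` (a component of the parameter)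
and the transformation `H` entering the prior of the unknown covariate. -/
structure InverseModel (lam : Measure ℝ) (X : Set ℝ) (Θ : Type*) [MeasurableSpace Θ]
    extends ResponseModel lam X Θ where
  base : Measure Θ
  sigmaFinite_base : SigmaFinite base
  priorDens : Θ → ℝ≥0
  measurable_priorDens : Measurable priorDens
  priorDens_pos : ∀ θ, 0 < priorDens θ
  prior_eq : prior = base.withDensity fun θ => (priorDens θ : ℝ≥0∞)
  eta : Θ → ℝ → ℝ
  measurable_eta : Measurable (Function.uncurry eta)
  H : ℝ → ℝ
  measurable_H : Measurable H

/-- The two discrepancy measures. -/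
inductive Discrepancy
  | T1
  | T2

/-- The summand of the discrepancy measure: `|v - μ| / √(σ² + c)` or `(v - μ)² / (σ² + c)`. -/
def Discrepancy.term (c : ℝ) : Discrepancy → ℝ → ℝ → ℝ → ℝ
  | .T1, v, mean, var => |v - mean| / √(var + c)
  | .T2, v, mean, var => (v - mean) ^ 2 / (var + c)

/-- Sample mean `ȳ_i` of the replicates. -/
def sampleMean {m : ℕ} (y : Fin m → ℝ) : ℝ := (∑ j, y j) / m

/-- Sample standard deviation `s_i` of the replicates. -/
def sampleSD {m : ℕ} (y : Fin m → ℝ) : ℝ :=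
  √((∑ j, (y j - sampleMean y) ^ 2) / ((m : ℝ) - 1))

/-- The ingredients of the multiple testing problem for `K` competing inverse models. -/
structure Problem (K : ℕ) (Θ₀ : Type u) [MeasurableSpace Θ₀]
    (Θ : Fin K → Type v) [∀ k, MeasurableSpace (Θ k)] where
  /-- common dominating measure of the responses -/
  lam : Measure ℝ
  sigmaFinite_lam : SigmaFinite lam
  /-- compact covariate space -/
  X : Set ℝ
  isCompact_X : IsCompact X
  volume_X_pos : 0 < volume X
  /-- observed covariates -/
  x : ℕ → ℝ
  x_mem : ∀ i, x i ∈ X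
  /-- the data-generating model, with its prior (possibly a point mass) -/
  truth : ResponseModel lam X Θ₀
  /-- the competing models -/
  model : ∀ k, InverseModel lam X (Θ k)
  /-- prior of the mixing probabilities `(p_1, …, p_K)` -/
  mixPrior : Measure (Fin K → ℝ)
  isProbabilityMeasure_mixPrior : IsProbabilityMeasure mixPrior
  mixPrior_simplex : ∀ᵐ p ∂mixPrior, p ∈ stdSimplex ℝ (Fin K)
  /-- every model has positive prior probability `P(ζ = k) = E(p_k)` -/
  mixPrior_pos : ∀ k, 0 < ∫ p, p k ∂mixPrior
  /-- the constant in the uniform prior of the unknown covariates -/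
  cB : ℝ
  one_le_cB : 1 ≤ cB
  /-- the constant in the discrepancy measures -/
  cT : ℝ
  cT_pos : 0 < cT
  /-- the chosen discrepancy measure of each model -/
  disc : Fin K → Discrepancy
  /-- the parameter regions `Θ̃_k` -/
  region : ∀ k, Set (Θ k)
  measurableSet_region : ∀ k, MeasurableSet (region k)
  /-- the constants `a_k` in the hypotheses -/
  a : Fin K → ℝ
  /-- the tolerance in the hypotheses -/
  ε : ℝ
  ε_pos : 0 < ε
  /-- end points of the credible intervals, as functions of the data -/
  lo : Fin K → (n m : ℕ) → Data n m → ℝ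
  measurable_lo : ∀ k n m, Measurable (lo k n m)
  up : Fin K → (n m : ℕ) → Data n m → ℝ
  measurable_up : ∀ k n m, Measurable (up k n m)

namespace Problem

variable {K : ℕ} {Θ₀ : Type u} [MeasurableSpace Θ₀]
  {Θ : Fin K → Type v} [∀ k, MeasurableSpace (Θ k)] (S : Problem K Θ₀ Θ)

/-- The covariate vector `X_n`. -/
def xs (n : ℕ) : Fin n → ℝ := fun i => S.x i

/-! ### Kullback–Leibler divergence rates and the conditions (S1)–(S7) -/

/-- The distribution of `Y_{nm}` under the true model. -/
def trueLaw (n m : ℕ) : Measure (Data n m) :=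
  (refMeasure S.lam n m).withDensity (S.truth.marginal (S.xs n))

/-- The distribution of `Y_{nm}` under the parameter `θ` of the model `k`. -/
def modelLaw (k : Fin K) (θ : Θ k) (n m : ℕ) : Measure (Data n m) :=
  (refMeasure S.lam n m).withDensity ((S.model k).likelihood (S.xs n) θ)

/-- The divergence rate `h_k(θ) = lim_n n⁻¹ KL(truth ‖ θ)`, for `m` replicates; that the limit
exists is condition (S2). -/
def klRate (k : Fin K) (m : ℕ) (θ : Θ k) : ℝ≥0∞ :=
  limsup (fun n : ℕ => InformationTheory.klDiv (S.trueLaw n m) (S.modelLaw k θ n m) / (n : ℝ≥0∞))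
    atTop

/-- `h_k(A)`, the essential infimum over `A` of the divergence rate, with respect to the prior. -/
def klInf (k : Fin K) (m : ℕ) (A : Set (Θ k)) : ℝ≥0∞ :=
  essInf (S.klRate k m) ((S.model k).prior.restrict A)

/-- The likelihood ratio `R_n(θ)` of the model `k` against the true model. -/
def ratio (k : Fin K) {n m : ℕ} (D : Data n m) (θ : Θ k) : ℝ≥0∞ :=
  (S.model k).likelihood (S.xs n) θ D / S.truth.marginal (S.xs n) D

/-- `n⁻¹ log r`, in the extended reals. -/
def scaledLog (n : ℕ) (r : ℝ≥0∞) : EReal := (((n : ℝ)⁻¹ : ℝ) : EReal) * ENNReal.log r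

end Problem

/-- The observed block `Y_{nm}` of an infinite array of responses. -/
def block {Ω : Type*} (Y : ℕ → ℕ → Ω → ℝ) (n m : ℕ) (ω : Ω) : Data n m := fun i j => Y i j ω

namespace Problem

variable {K : ℕ} {Θ₀ : Type u} [MeasurableSpace Θ₀]
  {Θ : Fin K → Type v} [∀ k, MeasurableSpace (Θ k)] (S : Problem K Θ₀ Θ)

/-- The array `Y` is generated by the true model. -/
structure IsGenerated {Ω : Type w} [MeasurableSpace Ω] (P : Measure Ω) (Y : ℕ → ℕ → Ω → ℝ) :
    Prop where
  measurable : ∀ i j, Measurable (Y i j)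
  law : ∀ n m, P.map (block Y n m) = S.trueLaw n m

/-- Conditions (S1)–(S7) for the model `k`, with `m` replicates at each covariate value. -/
structure Shalizi {Ω : Type w} [MeasurableSpace Ω] (P : Measure Ω) (Y : ℕ → ℕ → Ω → ℝ)
    (k : Fin K) (m : ℕ) : Prop where
  s1 : ∀ n : ℕ, 0 < n → Measurable fun q : Data n m × Θ k => S.ratio k q.1 q.2
  s2 : Measurable (S.klRate k m) ∧ ∀ θ : Θ k, Tendsto
    (fun n : ℕ => InformationTheory.klDiv (S.trueLaw n m) (S.modelLaw k θ n m) / (n : ℝ≥0∞))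
    atTop (𝓝 (S.klRate k m θ))
  s3 : ∀ θ : Θ k, ∀ᵐ ω ∂P, Tendsto (fun n : ℕ => scaledLog n (S.ratio k (block Y n m ω) θ))
    atTop (𝓝 (-(S.klRate k m θ : EReal)))
  s4 : (S.model k).prior {θ | S.klRate k m θ = ⊤} < 1
  /-- Conditions (S5), (S6), (S7), on a common sequence of sieves `G`. -/
  s567 : ∃ G : ℕ → Set (Θ k), (∀ n, MeasurableSet (G n)) ∧ (∀ θ, ∀ᶠ n in atTop, θ ∈ G n) ∧
    (∃ z γ : ℝ, 0 < z ∧ 2 * S.klInf k m Set.univ < ENNReal.ofReal γ ∧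
      ∀ n : ℕ, 1 - ENNReal.ofReal (z * Real.exp (-(γ * n))) ≤ (S.model k).prior (G n)) ∧
    -- uniform convergence over the part of `G n` where the rate is finite
    (∀ᵐ ω ∂P, ∀ δ : ℝ, 0 < δ → ∀ᶠ n : ℕ in atTop, ∀ θ ∈ G n, S.klRate k m θ ≠ ⊤ →
      -(S.klRate k m θ : EReal) - (δ : EReal) ≤ scaledLog n (S.ratio k (block Y n m ω) θ) ∧
      scaledLog n (S.ratio k (block Y n m ω) θ) ≤ -(S.klRate k m θ : EReal) + (δ : EReal)) ∧
    -- uniform divergence to `-∞` over the part of `G n` where the rate is infinite, up to prior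
    -- null sets: nothing is required here when the rate is finite almost everywhere
    (∀ᵐ ω ∂P, ∀ C : ℝ, ∀ᶠ n : ℕ in atTop, ∀ᵐ θ ∂(S.model k).prior,
      θ ∈ G n → S.klRate k m θ = ⊤ →
        scaledLog n (S.ratio k (block Y n m ω) θ) ≤ ((-C : ℝ) : EReal)) ∧
    Tendsto (fun n => S.klInf k m (G n)) atTop (𝓝 (S.klInf k m Set.univ)) ∧
    -- `n > τ(G n, δ)` for all sufficiently large `n`, almost surely
    (∀ δ : ℝ, 0 < δ → ∀ᵐ ω ∂P, ∀ᶠ n : ℕ in atTop, ∀ n' : ℕ, n ≤ n' →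
      scaledLog n' (∫⁻ θ in G n, S.ratio k (block Y n' m ω) θ ∂(S.model k).prior) ≤
        (δ : EReal) + limsup (fun l : ℕ =>
          scaledLog l (∫⁻ θ in G n, S.ratio k (block Y l m ω) θ ∂(S.model k).prior)) atTop) ∧
    (∀ A : Set (Θ k), MeasurableSet A → 0 < (S.model k).prior A →
      Tendsto (fun n => S.klInf k m (G n ∩ A)) atTop (𝓝 (S.klInf k m A)))

/-! ### Posteriors -/

/-- The prior probability `P(ζ = k) = E(p_k)`. -/
def weight (k : Fin K) : ℝ≥0∞ := ENNReal.ofReal (∫ p, p k ∂S.mixPrior)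

/-- The posterior probability `π(ζ = k | X_n, Y_{nm})`. -/
def postModel {n m : ℕ} (D : Data n m) (k : Fin K) : ℝ≥0∞ :=
  S.weight k * (S.model k).marginal (S.xs n) D /
    ∑ l, S.weight l * (S.model l).marginal (S.xs n) D

/-- The posterior probability `π(θ_k ∈ A | X_n, Y_{nm}, M_k)`. -/
def postParam {n m : ℕ} (D : Data n m) (k : Fin K) (A : Set (Θ k)) : ℝ≥0∞ :=
  (∫⁻ θ in A, (S.model k).likelihood (S.xs n) θ D ∂(S.model k).prior) /
    (S.model k).marginal (S.xs n) D

/-- The set `B_{im}(θ)`. -/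
def ball {n m : ℕ} (D : Data n m) (k : Fin K) (i : Fin n) (θ : Θ k) : Set ℝ :=
  {t | t ∈ S.X ∧ (S.model k).H ((S.model k).eta θ t) ∈
    Set.Icc (sampleMean (D i) - S.cB * sampleSD (D i) / √m)
      (sampleMean (D i) + S.cB * sampleSD (D i) / √m)}

open scoped Classical in
/-- The Lebesgue density of the uniform prior of the unknown covariate on `B_{im}(θ)`. -/
def covPrior {n m : ℕ} (D : Data n m) (k : Fin K) (i : Fin n) (θ : Θ k) (t : ℝ) : ℝ≥0∞ :=
  if t ∈ S.ball D k i θ then (volume (S.ball D k i θ))⁻¹ else 0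

/-- The unnormalised density of the `Θ̃_k`-restricted cross-validation posterior of the `i`-th
covariate: in the likelihood, the covariate `x_i` is replaced by the unknown `t`. -/
def cvDensity {n m : ℕ} (D : Data n m) (k : Fin K) (i : Fin n) (t : ℝ) : ℝ≥0∞ :=
  ∫⁻ θ in S.region k, S.covPrior D k i θ t *
    (S.model k).likelihood (Function.update (S.xs n) i t) θ D ∂(S.model k).prior

/-- The normalising constant of the restricted cross-validation posterior. -/
def cvNorm {n m : ℕ} (D : Data n m) (k : Fin K) (i : Fin n) : ℝ≥0∞ :=
  ∫⁻ t, S.cvDensity D k i t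

open scoped Classical in
/-- The `Θ̃_k`-restricted cross-validation posterior
`π(x̃_i | X_{n,-i}, Y_{nm}, M_k, Θ̃_k)`.  By convention it is uniform on the covariate space in the
degenerate case in which Bayes' formula has no meaning (for example because all the sets
`B_{im}(θ)` are empty). -/
def cvPosterior {n m : ℕ} (D : Data n m) (k : Fin K) (i : Fin n) : Measure ℝ :=
  if S.cvNorm D k i = 0 ∨ S.cvNorm D k i = ⊤ then (volume S.X)⁻¹ • volume.restrict S.X
  else (S.cvNorm D k i)⁻¹ • volume.withDensity (S.cvDensity D k i)

/-- The discrepancy `T^{(k)}(v_n)`. -/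
def T {n m : ℕ} (D : Data n m) (k : Fin K) (v : Fin n → ℝ) : ℝ :=
  (1 / (n : ℝ)) * ∑ i, (S.disc k).term S.cT (v i)
    (∫ t, t ∂(S.cvPosterior D k i)) (ProbabilityTheory.variance id (S.cvPosterior D k i))

/-- The posterior distribution of `T^{(k)}(X̃_n)` given the model `k` and `Θ̃_k`; the components of
`X̃_n` independently follow their cross-validation posteriors. -/
def discLaw {n m : ℕ} (D : Data n m) (k : Fin K) : Measure ℝ :=
  (Measure.pi fun i => S.cvPosterior D k i).map (S.T D k)

/-- `[lo, up]` is a `100(1-α)%` credible interval for the posterior of `T^{(k)}(X̃_n)`. -/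
def IsCredible (α : ℝ) : Prop :=
  ∀ k, ∀ n > 1, ∀ m > 1, ∀ D : Data n m,
    ENNReal.ofReal (1 - α) ≤ S.discLaw D k (Set.Icc (S.lo k n m D) (S.up k n m D))

/-- The constants `a_k` of the hypotheses are the limits of the observed discrepancies
`T^{(k)}(X_n)`. -/
def IsDiscrepancyLimit {Ω : Type w} [MeasurableSpace Ω] (P : Measure Ω) (Y : ℕ → ℕ → Ω → ℝ) :
    Prop :=
  ∀ k, ∀ᵐ ω ∂P, IterLim (fun n m => S.T (block Y n m ω) k (S.xs n)) (S.a k)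

/-! ### The multiple testing procedure -/

/-- The values `t` of `T^{(k)}(X̃_n)` with
`t - T^{(k)}(X_n) ∈ [lo - a_k - ε, up - a_k + ε]`. -/
def acceptSet {n m : ℕ} (D : Data n m) (k : Fin K) : Set ℝ :=
  {t | t - S.T D k (S.xs n) ∈
    Set.Icc (S.lo k n m D - S.a k - S.ε) (S.up k n m D - S.a k + S.ε)}

/-- The posterior probability `v_{knm}` of the alternative `H_{1k}`, the disjoint union of
`ζ ≠ k`, of `ζ = k, θ_k ∉ Θ̃_k`, and of
`ζ = k, θ_k ∈ Θ̃_k, T^{(k)}(X̃_n) ∉ acceptSet`. -/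
def postAlt {n m : ℕ} (D : Data n m) (k : Fin K) : ℝ :=
  ((∑ l ∈ Finset.univ.erase k, S.postModel D l) +
    S.postModel D k * S.postParam D k (S.region k)ᶜ +
    S.postModel D k * S.postParam D k (S.region k) * S.discLaw D k (S.acceptSet D k)ᶜ).toReal

open scoped Classical in
/-- The optimal decision configuration for the penalty `β`: reject the `k`-th null hypothesis when
`v_{knm} > β`. -/
def decision (β : ℝ) {n m : ℕ} (D : Data n m) : Fin K → Fin 2 :=
  fun k => if β < S.postAlt D k then 1 else 0

/-- `δ(d | X_n, Y_{nm})` for the (nonrandomised) optimal decision. -/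
def decisionProb (β : ℝ) {n m : ℕ} (D : Data n m) (d : Fin K → Fin 2) : ℝ :=
  if d = S.decision β D then 1 else 0

/-- The conditional false discovery rate. -/
def cFDR (β : ℝ) {n m : ℕ} (D : Data n m) : ℝ :=
  ∑ d : Fin K → Fin 2,
    (∑ k, ((d k : ℕ) : ℝ) * (1 - S.postAlt D k)) / max (∑ k, ((d k : ℕ) : ℝ)) 1 *
      S.decisionProb β D d

/-- The positive Bayesian false discovery rate: the expectation of the conditional one with respect
to the distribution of the data. -/
def pBFDR (β : ℝ) (n m : ℕ) : ℝ := ∫ D, S.cFDR β D ∂(S.trueLaw n m)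

end Problem

end InverseTest

end

/-! Everything reduces to one fact: almost surely, in the iterated limit, the posterior probability
`postAlt` of the alternative tends to 0 for `best` and to 1 for every other model
(`ae_postAlt_asymptotics`). The false discovery rate then has only two possible behaviours. If the
null of `best` is rejected, the penalty lies below a quantity close to 0, hence below every
`postAlt`; all K nulls are rejected, and the numerator is close to 1 because only `best`
contributes, giving 1/K. If it is not rejected, every term that remains has 1 - `postAlt` close to
0, giving 0.

For fixed m the model part of that fact compares exponential rates of the `evidence`, the prior
integral of the likelihood ratio. Above the rate `klInf univ`, Fatou's lemma makes the rescaled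
evidence explode (`tendsto_evidence_top`). Below both the rate of a set and the decay rate of the
prior outside the sieves, the rescaled evidence of that set vanishes (`tendsto_evidence_zero`).
Dividing, the posterior concentrates on `best` and, inside it, on its region.

The discrepancy part is Chebyshev's inequality. On a compact covariate space the summands are
bounded, so the posterior of the discrepancy concentrates at a point as n grows. A credible interval
of fixed positive mass must come near that point, so enlarging it by ε captures almost all of the
mass (`exists_discLaw_acceptSet_le`).

The unconditional rate follows by bounded convergence for iterated limits. A penalty that attains
1/K exists because `postAlt` of `best` is eventually positive: a nonrandom threshold can be put
below it with summable error probabilities, and Borel–Cantelli applies. -/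

namespace InverseTest

/-! ### Likelihoods and marginals as probability densities -/

/-- Tonelli for a product of functions of separate coordinates. -/
theorem lintegral_pi_prod {m : ℕ} (lam : Measure ℝ) [SigmaFinite lam] (f : Fin m → ℝ → ℝ≥0∞)
    (hf : ∀ j, Measurable (f j)) :
    ∫⁻ y : Fin m → ℝ, ∏ j, f j (y j) ∂(Measure.pi fun _ => lam) = ∏ j, ∫⁻ t, f j t ∂lam := by
  induction m with
  | zero => simp
  | succ m ih =>
    have e := (measurePreserving_piFinSuccAbove (fun _ : Fin (m + 1) => lam) 0).symm
    rw [← e.lintegral_comp (f := fun y : Fin (m + 1) → ℝ => ∏ j, f j (y j))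
      (Finset.measurable_fun_prod _ fun j _ => (hf j).comp (measurable_pi_apply j))]
    simp only [MeasurableEquiv.piFinSuccAbove_symm_apply, Fin.insertNthEquiv, Fin.insertNth_zero,
      Fin.prod_univ_succ, Equiv.coe_fn_mk, Fin.cons_zero, Fin.cons_succ]
    rw [← ih (fun j : Fin m => f j.succ) fun j => hf _]
    exact lintegral_prod_mul (hf 0).aemeasurable
      (Finset.measurable_fun_prod _ fun (j : Fin m) _ =>
        (hf j.succ).comp (measurable_pi_apply j)).aemeasurable

namespace ResponseModel

variable {lam : Measure ℝ} {X : Set ℝ} {Θ : Type*} [MeasurableSpace Θ]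

theorem measurable_likelihood (M : ResponseModel lam X Θ) (n m : ℕ) :
    Measurable fun q : (Fin n → ℝ) × Θ × Data n m => M.likelihood q.1 q.2.1 q.2.2 := by
  unfold likelihood
  refine Finset.measurable_fun_prod _ fun i _ => Finset.measurable_fun_prod _ fun j _ => ?_
  have h : Measurable fun q : (Fin n → ℝ) × Θ × Data n m =>
      (q.2.1, q.1 i, (fun l : Fin i => q.2.2 ⟨l, l.isLt.trans i.isLt⟩ j), q.2.2 i j) := by
    fun_prop
  exact ((M.measurable_dens i).comp h).coe_nnreal_ennreal

theorem measurable_likelihood_of (M : ResponseModel lam X Θ) {n m : ℕ} (x : Fin n → ℝ) :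
    Measurable fun q : Data n m × Θ => M.likelihood x q.2 q.1 :=
  (M.measurable_likelihood n m).comp
    (measurable_const.prodMk (measurable_snd.prodMk measurable_fst))

theorem measurable_marginal (M : ResponseModel lam X Θ) {n m : ℕ} (x : Fin n → ℝ) :
    Measurable (M.marginal (m := m) x) := by
  have := M.isProbabilityMeasure_prior
  exact (M.measurable_likelihood_of x).lintegral_prod_right'

/-- Each factor conditions on earlier responses only, so the last row can be integrated out first:
given the past its replicates are independent with total mass one, and what remains is the
likelihood of the first n rows. -/
theorem lintegral_likelihood [SigmaFinite lam] (M : ResponseModel lam X Θ) {n m : ℕ}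
    (x : Fin n → ℝ) (hx : ∀ i, x i ∈ X) (θ : Θ) :
    ∫⁻ D : Data n m, M.likelihood x θ D ∂(refMeasure lam n m) = 1 := by
  induction n with
  | zero => simp [likelihood, refMeasure]
  | succ n ih =>
    set μ : Measure (Fin m → ℝ) := Measure.pi fun _ => lam
    have e := (measurePreserving_piFinSuccAbove (fun _ : Fin (n + 1) => μ) (Fin.last n)).symm
    have hm : Measurable fun D : Data (n + 1) m => M.likelihood x θ D :=
      (M.measurable_likelihood_of x).comp (measurable_id.prodMk measurable_const)
    have := e.lintegral_comp hm
    -- The order of integration is chosen so that the newest row is the inner variable.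
    rw [refMeasure, ← this, lintegral_prod_symm]
    · have key : ∀ (D : Data n m) (y : Fin m → ℝ), M.likelihood x θ
          ((MeasurableEquiv.piFinSuccAbove (fun _ : Fin (n + 1) => Fin m → ℝ) (Fin.last n)).symm
            (y, D)) = M.likelihood (fun i => x i.castSucc) θ D *
            ∏ j, (M.dens n θ (x (Fin.last n)) (fun l => D l j) (y j) : ℝ≥0∞) := by
        intro D y
        simp only [likelihood, MeasurableEquiv.piFinSuccAbove_symm_apply, Fin.insertNthEquiv,
          Fin.prod_univ_castSucc, Equiv.coe_fn_mk, Fin.insertNth_last']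
        congr 1
        · refine Finset.prod_congr rfl fun i _ => Finset.prod_congr rfl fun j _ => ?_
          rw [Fin.snoc_castSucc]
          congr 2
          funext l
          exact congrFun (Fin.snoc_castSucc (α := fun _ => Fin m → ℝ) y D
            ⟨l, l.isLt.trans i.isLt⟩) j
        · refine Finset.prod_congr rfl fun j _ => ?_
          rw [Fin.snoc_last]
          congr 2
          funext l
          exact congrFun (Fin.snoc_castSucc (α := fun _ => Fin m → ℝ) y D l) j
      simp only [key]
      have h1 : ∀ D : Data n m, ∫⁻ y : Fin m → ℝ, M.likelihood (fun i => x i.castSucc) θ D *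
          ∏ j, (M.dens n θ (x (Fin.last n)) (fun l => D l j) (y j) : ℝ≥0∞) ∂μ
          = M.likelihood (fun i => x i.castSucc) θ D := by
        intro D
        have hd : ∀ j : Fin m, Measurable fun t =>
            (M.dens n θ (x (Fin.last n)) (fun l => D l j) t : ℝ≥0∞) := fun j =>
          ((M.measurable_dens n).comp (measurable_const.prodMk (measurable_const.prodMk
            (measurable_const.prodMk measurable_id)))).coe_nnreal_ennreal
        have hp : Measurable fun y : Fin m → ℝ =>
            ∏ j, (M.dens n θ (x (Fin.last n)) (fun l => D l j) (y j) : ℝ≥0∞) :=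
          Finset.measurable_fun_prod _ fun j _ => (hd j).comp (measurable_pi_apply j)
        rw [lintegral_const_mul _ hp, lintegral_pi_prod lam _ hd]
        simp [M.lintegral_dens n θ _ (hx _)]
      simp only [h1]
      exact ih _ fun i => hx _
    · exact (hm.comp (MeasurableEquiv.measurable _)).aemeasurable

theorem lintegral_marginal [SigmaFinite lam] (M : ResponseModel lam X Θ) {n m : ℕ}
    (x : Fin n → ℝ) (hx : ∀ i, x i ∈ X) :
    ∫⁻ D : Data n m, M.marginal x D ∂(refMeasure lam n m) = 1 := by
  have := M.isProbabilityMeasure_prior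
  have : SigmaFinite (refMeasure lam n m) := by unfold refMeasure; infer_instance
  unfold marginal
  rw [lintegral_lintegral_swap (M.measurable_likelihood_of x).aemeasurable]
  simp [M.lintegral_likelihood x hx]

end ResponseModel

theorem measurable_block {Ω : Type*} [MeasurableSpace Ω] {Y : ℕ → ℕ → Ω → ℝ}
    (hY : ∀ i j, Measurable (Y i j)) (n m : ℕ) : Measurable (block Y n m) :=
  measurable_pi_lambda _ fun i => measurable_pi_lambda _ fun j => hY i j

/-! ### Evidence and nondegenerate data -/

namespace Problem

variable {K : ℕ} {Θ₀ : Type u} [MeasurableSpace Θ₀]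
  {Θ : Fin K → Type v} [∀ k, MeasurableSpace (Θ k)] (S : Problem K Θ₀ Θ)

/-- The integral over `A` of the likelihood ratio with respect to the prior. -/
noncomputable def evidence (k : Fin K) {n m : ℕ} (D : Data n m) (A : Set (Θ k)) : ℝ≥0∞ :=
  ∫⁻ θ in A, S.ratio k D θ ∂(S.model k).prior

theorem measurable_ratio (k : Fin K) (n m : ℕ) :
    Measurable fun q : Data n m × Θ k => S.ratio k q.1 q.2 :=
  ((S.model k).measurable_likelihood_of (S.xs n)).div
    ((S.truth.measurable_marginal (S.xs n)).comp measurable_fst)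

theorem measurable_ratio_comp {k : Fin K} {n m : ℕ} {α : Type*} [MeasurableSpace α]
    {f : α → Data n m} {g : α → Θ k} (hf : Measurable f) (hg : Measurable g) :
    Measurable fun a => S.ratio k (f a) (g a) := by
  have h : Measurable fun a => (f a, g a) := hf.prodMk hg
  have h' := (S.measurable_ratio k n m).comp h
  exact h'

theorem measurable_evidence (k : Fin K) (n m : ℕ) (A : Set (Θ k)) :
    Measurable fun D : Data n m => S.evidence k D A := by
  have := (S.model k).isProbabilityMeasure_prior
  exact (S.measurable_ratio k n m).lintegral_prod_right'

/-- Data at which Bayes' formula is not degenerate. -/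
def Regular {n m : ℕ} (D : Data n m) : Prop :=
  S.truth.marginal (S.xs n) D ≠ 0 ∧ S.truth.marginal (S.xs n) D ≠ ⊤ ∧
    ∀ k, (S.model k).marginal (S.xs n) D ≠ ⊤

/-- A law does not charge the zero set of its own density, and marginals are finite almost
everywhere because they integrate to one. Nonvanishing of the competing marginals is not claimed
here; it is obtained later, for large n, from the growth of the evidence. -/
theorem ae_regular (n m : ℕ) : ∀ᵐ D ∂(S.trueLaw n m), S.Regular D := by
  have := S.sigmaFinite_lam
  have hx : ∀ i, S.xs n i ∈ S.X := fun i => S.x_mem i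
  have hac : S.trueLaw n m ≪ refMeasure S.lam n m := withDensity_absolutelyContinuous _ _
  have h0 : ∀ᵐ D ∂(S.trueLaw n m), S.truth.marginal (S.xs n) D ≠ 0 := by
    rw [trueLaw, ae_withDensity_iff (S.truth.measurable_marginal _)]
    exact ae_of_all _ fun D h => h
  have h1 : ∀ᵐ D ∂(S.trueLaw n m), S.truth.marginal (S.xs n) D ≠ ⊤ := by
    refine hac.ae_le ((ae_lt_top (S.truth.measurable_marginal _) ?_).mono fun D h => h.ne)
    rw [S.truth.lintegral_marginal _ hx]; simp
  have h2 : ∀ᵐ D ∂(S.trueLaw n m), ∀ k, (S.model k).marginal (S.xs n) D ≠ ⊤ := by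
    refine ae_all_iff.2 fun k => hac.ae_le
      ((ae_lt_top ((S.model k).measurable_marginal _) ?_).mono fun D h => h.ne)
    rw [(S.model k).lintegral_marginal _ hx]; simp
  filter_upwards [h0, h1, h2] with D a b c using ⟨a, b, c⟩

variable {S} {Ω : Type w} [MeasurableSpace Ω] {P : Measure Ω} {Y : ℕ → ℕ → Ω → ℝ}

theorem IsGenerated.measurable_block (hY : S.IsGenerated P Y) (n m : ℕ) :
    Measurable (block Y n m) := InverseTest.measurable_block hY.measurable n m

theorem IsGenerated.ae_regular (hY : S.IsGenerated P Y) :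
    ∀ᵐ ω ∂P, ∀ n m, S.Regular (block Y n m ω) := by
  refine ae_all_iff.2 fun n => ae_all_iff.2 fun m => ?_
  refine ae_of_ae_map (hY.measurable_block n m).aemeasurable ?_
  rw [hY.law]
  exact S.ae_regular n m

/-- The true density cancels against the denominator of the ratio. Only an inequality survives,
since the model may charge data where the true density vanishes. -/
theorem IsGenerated.lintegral_ratio_le (hY : S.IsGenerated P Y) (k : Fin K) (n m : ℕ) (θ : Θ k) :
    ∫⁻ ω, S.ratio k (block Y n m ω) θ ∂P ≤ 1 := by
  have := S.sigmaFinite_lam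
  have hm : Measurable fun D : Data n m => S.ratio k D θ :=
    S.measurable_ratio_comp measurable_id measurable_const
  have hl : Measurable fun D : Data n m => (S.model k).likelihood (S.xs n) θ D :=
    ((S.model k).measurable_likelihood_of (S.xs n)).comp measurable_prodMk_right
  rw [← lintegral_map hm (hY.measurable_block n m), hY.law, trueLaw,
    lintegral_withDensity_eq_lintegral_mul _ (S.truth.measurable_marginal _) hm,
    ← (S.model k).lintegral_likelihood (m := m) (S.xs n) (fun i => S.x_mem i) θ]
  exact lintegral_mono fun D => ENNReal.mul_div_le

/-- By Tonelli, the prior mass controls the expected evidence; this is what makes the complement of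
the sieves negligible. -/
theorem IsGenerated.lintegral_evidence_le (hY : S.IsGenerated P Y) [SFinite P] (k : Fin K)
    (n m : ℕ) (A : Set (Θ k)) :
    ∫⁻ ω, S.evidence k (block Y n m ω) A ∂P ≤ (S.model k).prior A := by
  have := (S.model k).isProbabilityMeasure_prior
  unfold evidence
  have hm : Measurable fun q : Ω × Θ k => S.ratio k (block Y n m q.1) q.2 :=
    S.measurable_ratio_comp ((hY.measurable_block n m).comp measurable_fst) measurable_snd
  rw [lintegral_lintegral_swap hm.aemeasurable]
  calc _ ≤ ∫⁻ _ in A, 1 ∂(S.model k).prior :=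
        lintegral_mono fun θ => hY.lintegral_ratio_le k n m θ
    _ = _ := by simp

/-- The true marginal is a factor common to all models, so posterior odds become ratios of
evidences. -/
theorem Regular.setLIntegral_likelihood {n m : ℕ} {D : Data n m} (hD : S.Regular D) (k : Fin K)
    (A : Set (Θ k)) :
    ∫⁻ θ in A, (S.model k).likelihood (S.xs n) θ D ∂(S.model k).prior
      = S.truth.marginal (S.xs n) D * S.evidence k D A := by
  have hm : Measurable fun θ : Θ k => S.ratio k D θ :=
    S.measurable_ratio_comp measurable_const measurable_id
  rw [evidence, ← lintegral_const_mul _ hm]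
  refine lintegral_congr fun θ => ?_
  rw [ratio, ENNReal.mul_div_cancel hD.1 hD.2.1]

theorem Regular.marginal_eq {n m : ℕ} {D : Data n m} (hD : S.Regular D) (k : Fin K) :
    (S.model k).marginal (S.xs n) D = S.truth.marginal (S.xs n) D * S.evidence k D Set.univ := by
  rw [← hD.setLIntegral_likelihood, Measure.restrict_univ]; rfl

end Problem

/-! ### Exponential rates of the evidence -/

namespace Problem

theorem scaledLog_le_iff {n : ℕ} (hn : 0 < n) (r : ℝ≥0∞) (a : ℝ) :
    scaledLog n r ≤ (a : EReal) ↔ r ≤ ENNReal.ofReal (Real.exp (a * n)) := by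
  have hn' : (0 : ℝ) < n := Nat.cast_pos.2 hn
  have h1 : scaledLog n r = ENNReal.log r / ((n : ℝ) : EReal) := by
    rw [scaledLog, EReal.coe_inv, mul_comm]; rfl
  rw [h1, EReal.div_le_iff_le_mul (by exact_mod_cast hn') (EReal.coe_ne_top _),
    ← ENNReal.log_le_log_iff, ENNReal.log_ofReal_of_pos (Real.exp_pos _), Real.log_exp, mul_comm a,
    EReal.coe_mul]

theorem lt_scaledLog_iff {n : ℕ} (hn : 0 < n) (r : ℝ≥0∞) (a : ℝ) :
    (a : EReal) < scaledLog n r ↔ ENNReal.ofReal (Real.exp (a * n)) < r := by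
  rw [← not_le, ← not_le, scaledLog_le_iff hn]

theorem ofReal_exp_mul (a b : ℝ) : ENNReal.ofReal (Real.exp a) * ENNReal.ofReal (Real.exp b)
    = ENNReal.ofReal (Real.exp (a + b)) := by
  rw [← ENNReal.ofReal_mul (Real.exp_pos _).le, Real.exp_add]

theorem tendsto_ofReal_exp_top {δ : ℝ} (hδ : 0 < δ) :
    Tendsto (fun n : ℕ => ENNReal.ofReal (Real.exp (δ * n))) atTop (𝓝 ⊤) :=
  ENNReal.tendsto_ofReal_atTop.comp
    (Real.tendsto_exp_atTop.comp (tendsto_natCast_atTop_atTop.const_mul_atTop hδ))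

theorem tendsto_ofReal_exp_zero {δ : ℝ} (hδ : 0 < δ) :
    Tendsto (fun n : ℕ => ENNReal.ofReal (Real.exp (-δ * n))) atTop (𝓝 0) := by
  have : Tendsto (fun n : ℕ => Real.exp (-δ * n)) atTop (𝓝 0) :=
    Real.tendsto_exp_atBot.comp (tendsto_natCast_atTop_atTop.const_mul_atTop_of_neg (by linarith))
  simpa using ENNReal.tendsto_ofReal this

variable {K : ℕ} {Θ₀ : Type u} [MeasurableSpace Θ₀]
  {Θ : Fin K → Type v} [∀ k, MeasurableSpace (Θ k)] {S : Problem K Θ₀ Θ}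
  {Ω : Type w} [MeasurableSpace Ω] {P : Measure Ω}
  {Y : ℕ → ℕ → Ω → ℝ} {k : Fin K} {m : ℕ}

/-- The evidence decays at most at the exponential rate `klInf univ`. -/
theorem Shalizi.tendsto_evidence_top [SFinite P] (h : S.Shalizi P Y k m)
    (hY : S.IsGenerated P Y) {c : ℝ≥0} (hc : S.klInf k m Set.univ < c) :
    ∀ᵐ ω ∂P, Tendsto (fun n : ℕ => ENNReal.ofReal (Real.exp (c * n)) *
      S.evidence k (block Y n m ω) Set.univ) atTop (𝓝 ⊤) := by
  have := (S.model k).isProbabilityMeasure_prior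
  set π := (S.model k).prior
  set B : Set (Θ k) := {θ | S.klRate k m θ < c}
  have hB : MeasurableSet B := measurableSet_lt h.s2.1 measurable_const
  -- Since c exceeds the essential infimum, the parameters with rate below c have positive prior
  -- mass; they alone make the evidence explode.
  have hB0 : π B ≠ 0 := by
    intro h0
    refine absurd hc (not_lt.2 ?_)
    rw [klInf, Measure.restrict_univ]
    refine le_essInf_of_ae_le _ ?_
    have : ∀ᵐ θ ∂π, θ ∉ B := measure_eq_zero_iff_ae_notMem.1 h0
    filter_upwards [this] with θ hθ using not_lt.1 hθ
  set f : ℕ → Ω × Θ k → ℝ≥0∞ := fun n q =>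
    ENNReal.ofReal (Real.exp (c * n)) * S.ratio k (block Y n m q.1) q.2
  have hf : ∀ n, Measurable (f n) := fun n => (S.measurable_ratio_comp
    ((hY.measurable_block n m).comp measurable_fst) measurable_snd).const_mul _
  set g : Ω × Θ k → ℝ≥0∞ := fun q => liminf (fun n => f n q) atTop
  have hg : Measurable g := Measurable.liminf hf
  have hg_top : ∀ᵐ θ ∂π, ∀ᵐ ω ∂P, θ ∈ B → g (ω, θ) = ⊤ := by
    refine ae_of_all _ fun θ => ?_
    filter_upwards [h.s3 θ] with ω hω hθ
    obtain ⟨c', hc', hcc'⟩ := ENNReal.lt_iff_exists_nnreal_btwn.1 hθ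
    have hcc'' : (0 : ℝ) < c - c' := sub_pos.2 (by exact_mod_cast hcc')
    refine Tendsto.liminf_eq (tendsto_nhds_top_mono (tendsto_ofReal_exp_top hcc'') ?_)
    have hlt : (((-c' : ℝ)) : EReal) < -(S.klRate k m θ : EReal) := by
      rw [EReal.coe_neg, EReal.neg_lt_neg_iff, ← EReal.coe_nnreal_eq_coe_real]
      exact EReal.coe_ennreal_lt_coe_ennreal_iff.2 hc'
    filter_upwards [hω.eventually_const_lt hlt, eventually_gt_atTop 0] with n h1 hn
    rw [lt_scaledLog_iff hn] at h1
    calc _ = ENNReal.ofReal (Real.exp (c * n)) * ENNReal.ofReal (Real.exp (-c' * n)) := by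
          rw [ofReal_exp_mul]; ring_nf
      _ ≤ _ := mul_le_mul_right h1.le _
  have hset : MeasurableSet {q : Ω × Θ k | q.2 ∈ B → g q = ⊤} := by
    have : {q : Ω × Θ k | q.2 ∈ B → g q = ⊤} = (Prod.snd ⁻¹' B)ᶜ ∪ g ⁻¹' {⊤} := by
      ext q
      simp only [Set.mem_ofPred_eq, Set.mem_union, Set.mem_compl_iff, Set.mem_preimage,
        Set.mem_singleton_iff, imp_iff_not_or]
    rw [this]
    exact (measurable_snd hB).compl.union (hg (measurableSet_singleton _))
  -- The exceptional event in (S3) depends on θ; Fubini exchanges the two quantifiers, so that one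
  -- realisation serves almost every θ.
  have hg_top' := (Measure.ae_ae_comm (μ := P) (ν := π)
    (p := fun ω θ => θ ∈ B → g (ω, θ) = ⊤) hset).2 hg_top
  filter_upwards [hg_top'] with ω hω
  have h1 : ∫⁻ θ, g (ω, θ) ∂π = ⊤ := by
    refine top_unique ?_
    calc (⊤ : ℝ≥0∞) = ∫⁻ _ in B, ⊤ ∂π := by
          rw [setLIntegral_const, ENNReal.top_mul hB0]
      _ ≤ ∫⁻ θ in B, g (ω, θ) ∂π := by
          refine setLIntegral_mono_ae' hB ?_
          filter_upwards [hω] with θ hθ hθB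
          rw [hθ hθB]
      _ ≤ _ := setLIntegral_le_lintegral _ _
  -- Fatou's lemma over the prior.
  have h2 : ∫⁻ θ, g (ω, θ) ∂π ≤ liminf (fun n : ℕ => ENNReal.ofReal (Real.exp (c * n)) *
      S.evidence k (block Y n m ω) Set.univ) atTop := by
    refine (lintegral_liminf_le fun n => (hf n).comp measurable_prodMk_left).trans_eq ?_
    congr 1
    funext n
    have hm : Measurable fun θ : Θ k => S.ratio k (block Y n m ω) θ :=
      S.measurable_ratio_comp measurable_const measurable_id
    rw [evidence, Measure.restrict_univ, ← lintegral_const_mul _ hm]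
    rfl
  exact tendsto_of_le_liminf_of_limsup_le (h1 ▸ h2) le_top

/-- The evidence of `A` decays at least at any exponential rate below `klInf A` and the rate at
which the prior concentrates on the sieves. -/
theorem Shalizi.tendsto_evidence_zero [SFinite P] (h : S.Shalizi P Y k m) (hY : S.IsGenerated P Y) :
    ∃ γ : ℝ, S.klInf k m Set.univ < ENNReal.ofReal γ ∧ ∀ A : Set (Θ k), MeasurableSet A →
      ∀ c : ℝ≥0, c < γ → c < S.klInf k m A →
      ∀ᵐ ω ∂P, Tendsto (fun n : ℕ => ENNReal.ofReal (Real.exp (c * n)) *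
        S.evidence k (block Y n m ω) A) atTop (𝓝 0) := by
  have := (S.model k).isProbabilityMeasure_prior
  obtain ⟨G, hG, -, ⟨z, γ, hz, hγ, hGz⟩, hfin, hinf, -⟩ := h.s567
  refine ⟨γ, lt_of_le_of_lt ?_ hγ, fun A hA c hcγ hcA => ?_⟩
  · rw [two_mul]; exact le_self_add
  set π := (S.model k).prior
  have hGc : ∀ n : ℕ, π (G n)ᶜ ≤ ENNReal.ofReal (z * Real.exp (-(γ * n))) := fun n => by
    rw [prob_compl_eq_one_sub (hG n), tsub_le_iff_left, ← tsub_le_iff_right]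
    exact hGz n
  obtain ⟨c', hcc', hc'A⟩ := ENNReal.lt_iff_exists_nnreal_btwn.1 hcA
  -- Half the gap: a uniform error δ in (S5) turns the rate c' into c' - δ = c + δ, which still
  -- beats c by δ.
  set δ : ℝ := (c' - c) / 2
  have hδ : 0 < δ := half_pos (sub_pos.2 (by exact_mod_cast hcc'))
  -- Outside the sieves, the expectations of the rescaled evidences are dominated by a geometric
  -- series with ratio exp (c - γ), so their sum is almost surely finite and its terms vanish.
  have hrest : ∀ᵐ ω ∂P, Tendsto (fun n : ℕ => ENNReal.ofReal (Real.exp (c * n)) *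
        S.evidence k (block Y n m ω) (G n)ᶜ) atTop (𝓝 0) := by
    have hm : ∀ n : ℕ, Measurable fun ω => ENNReal.ofReal (Real.exp (c * n)) *
        S.evidence k (block Y n m ω) (G n)ᶜ := fun n =>
      ((S.measurable_evidence k n m (G n)ᶜ).comp (hY.measurable_block n m)).const_mul _
    have hsum : Summable fun n : ℕ => z * Real.exp (n * (c - γ)) :=
      (Real.summable_exp_nat_mul_iff.2 (sub_neg.2 hcγ)).mul_left z
    have hlt : ∫⁻ ω, ∑' n : ℕ, ENNReal.ofReal (Real.exp (c * n)) *
        S.evidence k (block Y n m ω) (G n)ᶜ ∂P ≠ ⊤ := by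
      rw [lintegral_tsum fun n => (hm n).aemeasurable]
      refine ne_top_of_le_ne_top hsum.tsum_ofReal_ne_top (ENNReal.tsum_le_tsum fun n => ?_)
      have hm' : Measurable fun ω => S.evidence k (block Y n m ω) (G n)ᶜ :=
        (S.measurable_evidence k n m (G n)ᶜ).comp (hY.measurable_block n m)
      rw [lintegral_const_mul _ hm']
      calc _ ≤ ENNReal.ofReal (Real.exp (c * n)) *
            ENNReal.ofReal (z * Real.exp (-(γ * n))) := by
            gcongr
            exact (hY.lintegral_evidence_le k n m _).trans (hGc n)
        _ = _ := by
            rw [← ENNReal.ofReal_mul (Real.exp_pos _).le, mul_left_comm, ← Real.exp_add]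
            ring_nf
    filter_upwards [ae_lt_top (Measurable.tsum hm) hlt] with ω hω
    exact ENNReal.tendsto_atTop_zero_of_tsum_ne_top hω.ne
  filter_upwards [hrest, hfin, hinf] with ω hω hfinω hinfω
  have hlim : Tendsto (fun n : ℕ => ENNReal.ofReal (Real.exp (-δ * n)) +
      ENNReal.ofReal (Real.exp (c * n)) * S.evidence k (block Y n m ω) (G n)ᶜ) atTop (𝓝 0) := by
    simpa using (tendsto_ofReal_exp_zero hδ).add hω
  refine tendsto_of_tendsto_of_tendsto_of_le_of_le' tendsto_const_nhds hlim
    (Eventually.of_forall fun _ => zero_le) ?_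
  -- The level `c + δ` for infinite rates matches the bound for finite rates, so one estimate covers
  -- the sieve.
  filter_upwards [hfinω δ hδ, hinfω (c + δ), eventually_gt_atTop 0] with n h1 h2 hn
  have hbound : ∀ᵐ θ ∂π.restrict (A ∩ G n),
      S.ratio k (block Y n m ω) θ ≤ ENNReal.ofReal (Real.exp (-(c + δ) * n)) := by
    rw [ae_restrict_iff' (hA.inter (hG n))]
    have h3 : ∀ᵐ θ ∂π.restrict A, S.klInf k m A ≤ S.klRate k m θ := ae_essInf_le
    rw [ae_restrict_iff' hA] at h3
    filter_upwards [h2, h3] with θ h2θ h3θ hθ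
    rw [← scaledLog_le_iff hn]
    by_cases ht : S.klRate k m θ = ⊤
    · exact h2θ hθ.2 ht
    · refine (h1 θ hθ.2 ht).2.trans ?_
      have h4 : ((c' : ℝ) : EReal) ≤ (S.klRate k m θ : EReal) := by
        rw [← EReal.coe_nnreal_eq_coe_real]
        exact EReal.coe_ennreal_le_coe_ennreal_iff.2 (hc'A.le.trans (h3θ hθ.1))
      calc -(S.klRate k m θ : EReal) + (δ : EReal) ≤ -((c' : ℝ) : EReal) + (δ : EReal) := by
            gcongr
            exact EReal.neg_le_neg_iff.2 h4
        _ = ((-(c + δ) : ℝ) : EReal) := by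
            rw [← EReal.coe_neg, ← EReal.coe_add]
            congr 1
            simp only [δ]; ring
  have hsplit : S.evidence k (block Y n m ω) A ≤
      S.evidence k (block Y n m ω) (A ∩ G n) + S.evidence k (block Y n m ω) (G n)ᶜ := by
    refine (lintegral_mono_set ?_).trans (lintegral_union_le _ _ _)
    intro θ hθ
    by_cases h : θ ∈ G n
    · exact Or.inl ⟨hθ, h⟩
    · exact Or.inr h
  have hmain : S.evidence k (block Y n m ω) (A ∩ G n) ≤
      ENNReal.ofReal (Real.exp (-(c + δ) * n)) := by
    calc _ ≤ ∫⁻ _ in A ∩ G n, ENNReal.ofReal (Real.exp (-(c + δ) * n)) ∂π :=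
          lintegral_mono_ae hbound
      _ ≤ _ := by
          rw [setLIntegral_const]
          exact mul_le_of_le_one_right' prob_le_one
  calc _ ≤ ENNReal.ofReal (Real.exp (c * n)) * (ENNReal.ofReal (Real.exp (-(c + δ) * n)) +
          S.evidence k (block Y n m ω) (G n)ᶜ) := by
        gcongr
        exact hsplit.trans (by gcongr)
    _ = _ := by
        rw [mul_add, ofReal_exp_mul]
        ring_nf

/-- An infinite essential infimum would make the rate infinite almost everywhere, against (S4). -/
theorem Shalizi.klInf_lt_top (h : S.Shalizi P Y k m) : S.klInf k m Set.univ < ⊤ := by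
  have := (S.model k).isProbabilityMeasure_prior
  refine lt_top_iff_ne_top.2 fun h0 => h.s4.ne ?_
  have h3 : ∀ᵐ θ ∂(S.model k).prior, S.klInf k m Set.univ ≤ S.klRate k m θ := by
    rw [klInf, Measure.restrict_univ]; exact ae_essInf_le
  rw [h0] at h3
  exact (mem_ae_iff_prob_eq_one (h.s2.1 (measurableSet_singleton ⊤))).1
    (h3.mono fun θ => top_unique)

end Problem

/-! ### Posterior concentration on the best model and its region -/

namespace Problem

variable {K : ℕ} {Θ₀ : Type u} [MeasurableSpace Θ₀]
  {Θ : Fin K → Type v} [∀ k, MeasurableSpace (Θ k)] {S : Problem K Θ₀ Θ}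

theorem weight_ne_zero (k : Fin K) : S.weight k ≠ 0 :=
  (ENNReal.ofReal_pos.2 (S.mixPrior_pos k)).ne'

theorem weight_ne_top (k : Fin K) : S.weight k ≠ ⊤ := ENNReal.ofReal_ne_top

theorem sum_postModel_le_one {n m : ℕ} (D : Data n m) : ∑ k, S.postModel D k ≤ 1 := by
  simp only [postModel, div_eq_mul_inv, ← Finset.sum_mul]
  exact ENNReal.mul_inv_le_one _

theorem Regular.sum_weight_ne_top {n m : ℕ} {D : Data n m} (hD : S.Regular D) :
    ∑ l, S.weight l * (S.model l).marginal (S.xs n) D ≠ ⊤ :=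
  ENNReal.sum_ne_top.2 fun l _ => ENNReal.mul_ne_top (weight_ne_top l) (hD.2.2 l)

theorem Regular.postModel_pos {n m : ℕ} {D : Data n m} (hD : S.Regular D) {k : Fin K}
    (hk : S.evidence k D Set.univ ≠ 0) : 0 < S.postModel D k := by
  refine ENNReal.div_pos (mul_ne_zero (weight_ne_zero k) ?_) hD.sum_weight_ne_top
  rw [hD.marginal_eq]
  exact mul_ne_zero hD.1 hk

theorem Regular.sum_postModel {n m : ℕ} {D : Data n m} (hD : S.Regular D) {k : Fin K}
    (hk : S.evidence k D Set.univ ≠ 0) : ∑ l, S.postModel D l = 1 := by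
  simp only [postModel, div_eq_mul_inv, ← Finset.sum_mul]
  refine ENNReal.mul_inv_cancel (fun h0 => ?_) hD.sum_weight_ne_top
  refine absurd (Finset.sum_eq_zero_iff.1 h0 k (Finset.mem_univ k)) ?_
  rw [hD.marginal_eq]
  exact mul_ne_zero (weight_ne_zero k) (mul_ne_zero hD.1 hk)

/-- In the denominator of Bayes' formula, only the term of `j` is kept. -/
theorem Regular.postModel_le {n m : ℕ} {D : Data n m} (hD : S.Regular D) (k j : Fin K) :
    S.postModel D k ≤ S.weight k / S.weight j *
      (S.evidence k D Set.univ / S.evidence j D Set.univ) := by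
  calc S.postModel D k ≤ S.weight k * (S.model k).marginal (S.xs n) D /
        (S.weight j * (S.model j).marginal (S.xs n) D) := by
        refine ENNReal.div_le_div_left ?_ _
        exact Finset.single_le_sum (f := fun l => S.weight l * (S.model l).marginal (S.xs n) D)
          (fun _ _ => zero_le) (Finset.mem_univ j)
    _ = _ := by
        rw [hD.marginal_eq, hD.marginal_eq,
          ENNReal.mul_div_mul_comm (Or.inl (weight_ne_zero j)) (Or.inl (weight_ne_top j)),
          ENNReal.mul_div_mul_left _ _ hD.1 hD.2.1]

theorem Regular.postParam_eq {n m : ℕ} {D : Data n m} (hD : S.Regular D) (k : Fin K)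
    (A : Set (Θ k)) :
    S.postParam D k A = S.evidence k D A / S.evidence k D Set.univ := by
  rw [postParam, hD.setLIntegral_likelihood, hD.marginal_eq,
    ENNReal.mul_div_mul_left _ _ hD.1 hD.2.1]

theorem postParam_add_compl_le {n m : ℕ} (D : Data n m) (k : Fin K) :
    S.postParam D k (S.region k)ᶜ + S.postParam D k (S.region k) ≤ 1 := by
  rw [postParam, postParam, ← ENNReal.add_div, add_comm,
    lintegral_add_compl _ (S.measurableSet_region k)]
  exact ENNReal.div_self_le_one

theorem tendsto_div_zero_of_scaled {a b x : ℕ → ℝ≥0∞} (hx0 : ∀ n, x n ≠ 0) (hx : ∀ n, x n ≠ ⊤)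
    (ha : Tendsto (fun n => x n * a n) atTop (𝓝 0))
    (hb : Tendsto (fun n => x n * b n) atTop (𝓝 ⊤)) :
    Tendsto (fun n => a n / b n) atTop (𝓝 0) := by
  have := ENNReal.Tendsto.div ha (Or.inr ENNReal.top_ne_zero) hb (Or.inr ENNReal.zero_ne_top)
  simpa [ENNReal.mul_div_mul_left _ _ (hx0 _) (hx _)] using this

variable {Ω : Type w} [MeasurableSpace Ω] {P : Measure Ω} [SFinite P] {Y : ℕ → ℕ → Ω → ℝ}
  {k : Fin K} {m : ℕ}

theorem Shalizi.eventually_evidence_ne_zero (h : S.Shalizi P Y k m) (hY : S.IsGenerated P Y) :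
    ∀ᵐ ω ∂P, ∀ᶠ n in atTop, S.evidence k (block Y n m ω) Set.univ ≠ 0 := by
  obtain ⟨c, hc, -⟩ := ENNReal.lt_iff_exists_nnreal_btwn.1 h.klInf_lt_top
  filter_upwards [h.tendsto_evidence_top hY hc] with ω hω
  filter_upwards [hω.eventually_const_lt (u := 0) ENNReal.coe_lt_top] with n hn h0
  simp [h0] at hn

/-- The evidence of a set on which the divergence rate is larger than that of the model `j` is
asymptotically negligible compared with the evidence of `j`. -/
theorem Shalizi.tendsto_evidence_div {j : Fin K} (hk : S.Shalizi P Y k m) (hj : S.Shalizi P Y j m)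
    (hY : S.IsGenerated P Y) {A : Set (Θ k)} (hA : MeasurableSet A)
    (hle : S.klInf j m Set.univ ≤ S.klInf k m Set.univ)
    (hlt : S.klInf j m Set.univ < S.klInf k m A) :
    ∀ᵐ ω ∂P, Tendsto (fun n => S.evidence k (block Y n m ω) A /
      S.evidence j (block Y n m ω) Set.univ) atTop (𝓝 0) := by
  obtain ⟨γ, hγ, hzero⟩ := hk.tendsto_evidence_zero hY
  -- A single exponent separates the two evidences: rescaled by it, that of `j` explodes and that of
  -- `A` vanishes. The hypothesis `hle` places the rate of `j` below γ.
  obtain ⟨c, hjc, hc⟩ := ENNReal.lt_iff_exists_nnreal_btwn.1 (lt_min (hle.trans_lt hγ) hlt)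
  have hcγ : (c : ℝ) < γ := by
    have := hc.trans_le (min_le_left _ _)
    rw [← ENNReal.ofReal_coe_nnreal] at this
    exact (ENNReal.ofReal_lt_ofReal_iff'.1 this).1
  filter_upwards [hzero A hA c hcγ (hc.trans_le (min_le_right _ _)),
    hj.tendsto_evidence_top hY hjc] with ω h1 h2
  exact tendsto_div_zero_of_scaled (fun n => (ENNReal.ofReal_pos.2 (Real.exp_pos _)).ne')
    (fun n => ENNReal.ofReal_ne_top) h1 h2

/-- The posterior concentrates on the best model. -/
theorem tendsto_postModel (hY : S.IsGenerated P Y) (hS : ∀ k, S.Shalizi P Y k m) {best : Fin K}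
    (hbest : ∀ k, k ≠ best → S.klInf best m Set.univ < S.klInf k m Set.univ) :
    ∀ᵐ ω ∂P, Tendsto (fun n => ∑ l ∈ Finset.univ.erase best, S.postModel (block Y n m ω) l)
        atTop (𝓝 0) ∧
      Tendsto (fun n => S.postModel (block Y n m ω) best) atTop (𝓝 1) := by
  have h1 : ∀ k, ∀ᵐ ω ∂P, k ≠ best → Tendsto (fun n => S.evidence k (block Y n m ω) Set.univ /
      S.evidence best (block Y n m ω) Set.univ) atTop (𝓝 0) := fun k => by
    by_cases hk : k = best
    · exact ae_of_all _ fun _ h => absurd hk h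
    · filter_upwards [(hS k).tendsto_evidence_div (hS best) hY MeasurableSet.univ
        (hbest k hk).le (hbest k hk)] with ω hω _ using hω
  filter_upwards [ae_all_iff.2 h1, hY.ae_regular, (hS best).eventually_evidence_ne_zero hY]
    with ω hω hreg hne
  have hsum : Tendsto (fun n => ∑ l ∈ Finset.univ.erase best, S.postModel (block Y n m ω) l)
      atTop (𝓝 0) := by
    rw [← Finset.sum_const_zero (s := Finset.univ.erase best)]
    refine tendsto_finsetSum _ fun l hl => ?_
    have h2 := ENNReal.Tendsto.const_mul (a := S.weight l / S.weight best)
      (hω l (Finset.ne_of_mem_erase hl))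
      (Or.inr (ENNReal.div_lt_top (weight_ne_top l) (weight_ne_zero best)).ne)
    rw [mul_zero] at h2
    exact tendsto_of_tendsto_of_tendsto_of_le_of_le tendsto_const_nhds h2
      (fun _ => zero_le) fun n => (hreg n m).postModel_le l best
  refine ⟨hsum, ?_⟩
  have h3 := ENNReal.Tendsto.sub (tendsto_const_nhds (x := (1 : ℝ≥0∞))) hsum
    (Or.inl ENNReal.one_ne_top)
  rw [tsub_zero] at h3
  refine h3.congr' ?_
  filter_upwards [hne] with n hn
  have h4 := (hreg n m).sum_postModel hn
  rw [← Finset.add_sum_erase _ _ (Finset.mem_univ best)] at h4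
  refine (ENNReal.eq_sub_of_add_eq ?_ h4).symm
  refine ne_top_of_le_ne_top ENNReal.one_ne_top (h4 ▸ le_add_self)

/-- The evidence comparison is applied with both models equal, within model `k`. -/
theorem tendsto_postParam (hY : S.IsGenerated P Y) (h : S.Shalizi P Y k m)
    (hreg : S.klInf k m Set.univ < S.klInf k m (S.region k)ᶜ) :
    ∀ᵐ ω ∂P, Tendsto (fun n => S.postParam (block Y n m ω) k (S.region k)ᶜ) atTop (𝓝 0) := by
  filter_upwards [h.tendsto_evidence_div h hY (S.measurableSet_region k).compl le_rfl hreg,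
    hY.ae_regular] with ω hω hr
  exact hω.congr fun n => ((hr n m).postParam_eq k _).symm

end Problem

/-! ### Concentration of the discrepancy -/

theorem Discrepancy.term_nonneg (d : Discrepancy) {c : ℝ} (hc : 0 < c) (v e : ℝ) {V : ℝ}
    (hV : 0 ≤ V) : 0 ≤ d.term c v e V := by
  cases d <;> simp only [Discrepancy.term] <;> positivity

/-- Adding the bounds of the two discrepancies gives one constant for both; c > 0 keeps the
denominators away from zero. -/
theorem Discrepancy.term_le (d : Discrepancy) {c R : ℝ} (hc : 0 < c) {v e V : ℝ}
    (hv : |v| ≤ R) (he : |e| ≤ R) (hV : 0 ≤ V) :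
    d.term c v e V ≤ 2 * R / √c + (2 * R) ^ 2 / c := by
  have hR : 0 ≤ R := (abs_nonneg v).trans hv
  have hve : |v - e| ≤ 2 * R := (abs_sub v e).trans (by linarith)
  have hcV : c ≤ V + c := by linarith
  have h1 : 0 ≤ 2 * R / √c := by positivity
  have h2 : 0 ≤ (2 * R) ^ 2 / c := by positivity
  cases d <;> simp only [Discrepancy.term]
  · have : |v - e| / √(V + c) ≤ 2 * R / √c := by gcongr
    linarith
  · have : (v - e) ^ 2 / (V + c) ≤ (2 * R) ^ 2 / c := by
      have h3 : (v - e) ^ 2 ≤ (2 * R) ^ 2 := by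
        rw [← sq_abs]; gcongr
      gcongr
    linarith

theorem Discrepancy.measurable_term (d : Discrepancy) (c : ℝ) {α : Type*} [MeasurableSpace α]
    {v e V : α → ℝ} (hv : Measurable v) (he : Measurable e) (hV : Measurable V) :
    Measurable fun a => d.term c (v a) (e a) (V a) := by
  cases d <;> simp only [Discrepancy.term] <;> fun_prop

/-- Chebyshev's inequality for the mean of independent bounded random variables. -/
theorem exists_mean_concentration {n : ℕ} (hn : 0 < n) (ν : Fin n → Measure ℝ)
    [∀ i, IsProbabilityMeasure (ν i)] {f : Fin n → ℝ → ℝ} (hf : ∀ i, Measurable (f i)) {B : ℝ}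
    (hfb : ∀ i, ∀ᵐ t ∂(ν i), f i t ∈ Set.Icc 0 B) :
    ∃ μ : ℝ, ∀ δ > 0, Measure.pi ν {v | δ ≤ |1 / (n : ℝ) * ∑ i, f i (v i) - μ|} ≤
      ENNReal.ofReal (B ^ 2 / (n * δ ^ 2)) := by
  have hfL : ∀ i, MemLp (f i) 2 (ν i) := fun i =>
    memLp_of_bounded (hfb i) (hf i).aestronglyMeasurable 2
  have hT : (fun v : Fin n → ℝ => 1 / (n : ℝ) * ∑ i, f i (v i)) =
      fun v => 1 / (n : ℝ) * (∑ i, fun v : Fin n → ℝ => f i (v i)) v := by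
    funext v; simp
  have hTL : MemLp (fun v : Fin n → ℝ => 1 / (n : ℝ) * ∑ i, f i (v i)) 2 (Measure.pi ν) := by
    rw [hT]
    have h1 : ∀ i, MemLp (fun v : Fin n → ℝ => f i (v i)) 2 (Measure.pi ν) := fun i =>
      (hfL i).comp_measurePreserving (measurePreserving_eval ν i)
    have h2 : MemLp (∑ i, fun v : Fin n → ℝ => f i (v i)) 2 (Measure.pi ν) :=
      memLp_finsetSum' _ fun i _ => h1 i
    exact h2.const_mul _
  have hvar : ProbabilityTheory.variance (fun v : Fin n → ℝ => 1 / (n : ℝ) * ∑ i, f i (v i))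
      (Measure.pi ν) ≤ B ^ 2 / n := by
    rw [hT, ProbabilityTheory.variance_const_mul, ProbabilityTheory.variance_sum_pi hfL]
    have hn' : (0 : ℝ) < n := Nat.cast_pos.2 hn
    have : ∑ i, ProbabilityTheory.variance (f i) (ν i) ≤ n * B ^ 2 := by
      calc _ ≤ ∑ _ : Fin n, B ^ 2 := Finset.sum_le_sum fun i _ =>
            (ProbabilityTheory.variance_le_sq_of_bounded (hfb i) (hf i).aemeasurable).trans
              (by nlinarith [sq_nonneg B])
        _ = _ := by simp
    calc _ ≤ (1 / (n : ℝ)) ^ 2 * (n * B ^ 2) := by gcongr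
      _ = _ := by field_simp
  refine ⟨_, fun δ hδ => (ProbabilityTheory.meas_ge_le_variance_div_sq hTL hδ).trans
    (ENNReal.ofReal_le_ofReal ?_)⟩
  rw [← div_div]
  gcongr

namespace Problem

variable {K : ℕ} {Θ₀ : Type u} [MeasurableSpace Θ₀]
  {Θ : Fin K → Type v} [∀ k, MeasurableSpace (Θ k)] (S : Problem K Θ₀ Θ)

instance isProbabilityMeasure_cvPosterior {n m : ℕ} (D : Data n m) (k : Fin K) (i : Fin n) :
    IsProbabilityMeasure (S.cvPosterior D k i) := by
  refine ⟨?_⟩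
  unfold cvPosterior
  split_ifs with h
  · rw [Measure.smul_apply, Measure.restrict_apply_univ, smul_eq_mul]
    exact ENNReal.inv_mul_cancel S.volume_X_pos.ne' S.isCompact_X.measure_lt_top.ne
  · rw [not_or] at h
    rw [Measure.smul_apply, withDensity_apply _ MeasurableSet.univ, Measure.restrict_univ,
      smul_eq_mul]
    exact ENNReal.inv_mul_cancel h.1 h.2

/-- The prior of the unknown covariate lives on `ball`, a subset of the covariate space, so the
unnormalised density vanishes elsewhere. -/
theorem ae_mem_cvPosterior {n m : ℕ} (D : Data n m) (k : Fin K) (i : Fin n) :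
    ∀ᵐ t ∂(S.cvPosterior D k i), t ∈ S.X := by
  have hX := S.isCompact_X.measurableSet
  unfold cvPosterior
  split_ifs with h
  · exact Measure.ae_smul_measure (ae_restrict_mem hX) _
  · refine Measure.ae_smul_measure ?_ _
    rw [ae_iff]
    change volume.withDensity (S.cvDensity D k i) S.Xᶜ = 0
    rw [withDensity_apply _ hX.compl]
    refine (setLIntegral_congr_fun hX.compl fun t ht => ?_).trans lintegral_zero
    have : ∀ θ, S.covPrior D k i θ t = 0 := fun θ => if_neg fun h => ht h.1
    simp [cvDensity, this]

/-- The discrepancy terms are bounded on the covariate space. -/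
theorem exists_term_bound : ∃ B : ℝ, 0 < B ∧ ∀ (n m : ℕ) (D : Data n m) (k : Fin K) (i : Fin n),
    ∀ v ∈ S.X, (S.disc k).term S.cT v (∫ t, t ∂(S.cvPosterior D k i))
      (ProbabilityTheory.variance id (S.cvPosterior D k i)) ∈ Set.Icc 0 B := by
  obtain ⟨R, hR⟩ := S.isCompact_X.isBounded.exists_norm_le
  have hc := S.cT_pos
  refine ⟨2 * R / √S.cT + (2 * R) ^ 2 / S.cT + 1, ?_, fun n m D k i v hv => ⟨?_, ?_⟩⟩
  · have : 0 ≤ R := (norm_nonneg _).trans (hR _ (S.x_mem 0))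
    positivity
  · exact Discrepancy.term_nonneg _ hc _ _ (ProbabilityTheory.variance_nonneg _ _)
  · have hE : |∫ t, t ∂(S.cvPosterior D k i)| ≤ R := by
      have := norm_integral_le_of_norm_le_const (μ := S.cvPosterior D k i) (f := fun t => t)
        ((S.ae_mem_cvPosterior D k i).mono fun t ht => hR t ht)
      simpa using this
    have := Discrepancy.term_le (S.disc k) hc (hR v hv) hE
      (ProbabilityTheory.variance_nonneg id (S.cvPosterior D k i))
    linarith

theorem measurable_T {n m : ℕ} (D : Data n m) (k : Fin K) : Measurable (S.T D k) := by
  unfold T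
  exact (Finset.measurable_fun_sum _ fun i _ => (S.disc k).measurable_term S.cT
    (measurable_pi_apply i) measurable_const measurable_const).const_mul _

instance isProbabilityMeasure_discLaw {n m : ℕ} (D : Data n m) (k : Fin K) :
    IsProbabilityMeasure (S.discLaw D k) :=
  Measure.isProbabilityMeasure_map (S.measurable_T D k).aemeasurable

/-- The posterior of the discrepancy concentrates around a point, uniformly in the data. -/
theorem exists_discLaw_concentration : ∃ B : ℝ, 0 < B ∧ ∀ n > 0, ∀ (m : ℕ) (D : Data n m)
    (k : Fin K), ∃ μ : ℝ, ∀ δ > 0,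
      S.discLaw D k {t | δ ≤ |t - μ|} ≤ ENNReal.ofReal (B / (n * δ ^ 2)) := by
  obtain ⟨B, hB, hterm⟩ := S.exists_term_bound
  refine ⟨B ^ 2, by positivity, fun n hn m D k => ?_⟩
  obtain ⟨μ, hμ⟩ := exists_mean_concentration hn (S.cvPosterior D k)
    (f := fun i v => (S.disc k).term S.cT v (∫ t, t ∂(S.cvPosterior D k i))
      (ProbabilityTheory.variance id (S.cvPosterior D k i)))
    (fun i => (S.disc k).measurable_term S.cT measurable_id measurable_const measurable_const)
    fun i => (S.ae_mem_cvPosterior D k i).mono fun t ht => hterm n m D k i t ht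
  refine ⟨μ, fun δ hδ => ?_⟩
  have hset : MeasurableSet {t : ℝ | δ ≤ |t - μ|} := measurableSet_le measurable_const (by fun_prop)
  rw [discLaw, Measure.map_apply (S.measurable_T D k) hset]
  exact hμ δ hδ

/-- The posterior probability of missing the enlarged credible interval vanishes. -/
theorem exists_discLaw_acceptSet_le {α : ℝ} (hα : α < 1) (hcred : S.IsCredible α) :
    ∃ C : ℝ, 0 < C ∧ ∀ᶠ n : ℕ in atTop, ∀ m > 1, ∀ (D : Data n m) (k : Fin K),
      |S.T D k (S.xs n) - S.a k| < S.ε / 2 →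
      S.discLaw D k (S.acceptSet D k)ᶜ ≤ ENNReal.ofReal (C / n) := by
  obtain ⟨B, hB, hconc⟩ := S.exists_discLaw_concentration
  have hε := S.ε_pos
  -- The tolerance is split: two points within δ of the centre differ by less than ε/2, and the
  -- other ε/2 pays for replacing `T` at the true covariates by its limit.
  set δ := S.ε / 4
  have hδ : 0 < δ := by positivity
  refine ⟨B / δ ^ 2, by positivity, ?_⟩
  have hlim : Tendsto (fun n : ℕ => B / δ ^ 2 / (n : ℝ)) atTop (𝓝 0) :=
    tendsto_const_nhds.div_atTop tendsto_natCast_atTop_atTop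
  filter_upwards [hlim.eventually_lt_const (sub_pos.2 hα), eventually_gt_atTop 1]
    with n hn hn1 m hm D k hT
  obtain ⟨μ, hμ⟩ := hconc n (by omega) m D k
  have hμδ := hμ δ hδ
  rw [mul_comm, ← div_div] at hμδ
  refine le_trans (measure_mono ?_) hμδ
  -- An interval missing the δ-neighbourhood of the centre would have mass below 1 - α.
  obtain ⟨t₀, ⟨h1, h2⟩, h3⟩ : ∃ t, t ∈ Set.Icc (S.lo k n m D) (S.up k n m D) ∧ |t - μ| < δ := by
    by_contra! hcon
    have h4 : S.discLaw D k (Set.Icc (S.lo k n m D) (S.up k n m D)) ≤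
        ENNReal.ofReal (B / δ ^ 2 / n) := (measure_mono fun t ht => hcon t ht).trans hμδ
    have h5 := (hcred k n hn1 m hm D).trans h4
    exact absurd h5 (not_le.2 ((ENNReal.ofReal_lt_ofReal_iff (sub_pos.2 hα)).2 hn))
  intro t ht
  by_contra hlt
  refine ht ?_
  simp only [Set.mem_ofPred_eq, not_le] at hlt
  rw [abs_lt] at hlt h3 hT
  constructor <;> simp only [δ] at * <;> linarith [hlt.1, hlt.2, h3.1, h3.2, hT.1, hT.2]

end Problem

/-! ### Measurability of the procedure in the data -/

theorem measurable_measure_pi {α : Type*} [MeasurableSpace α] {n : ℕ} {κ : Fin n → α → Measure ℝ}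
    [∀ i a, IsProbabilityMeasure (κ i a)] (hκ : ∀ i, Measurable (κ i)) :
    Measurable fun a => Measure.pi fun i => κ i a := by
  refine Measurable.measure_of_isPiSystem_of_isProbabilityMeasure generateFrom_pi.symm
    isPiSystem_pi ?_
  rintro _ ⟨s, hs, rfl⟩
  simp only [Measure.pi_pi]
  exact Finset.measurable_fun_prod _ fun i _ =>
    Measure.measurable_measure.1 (hκ i) _ (hs i (Set.mem_univ i))

theorem measurable_integral_id {α : Type*} [MeasurableSpace α] {κ : α → Measure ℝ}
    (hκ : Measurable κ) : Measurable fun a => ∫ t, t ∂(κ a) :=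
  (StronglyMeasurable.integral_kernel (κ := (⟨κ, hκ⟩ : ProbabilityTheory.Kernel α ℝ))
    (f := fun t : ℝ => t) stronglyMeasurable_id).measurable

theorem measurable_variance_id {α : Type*} [MeasurableSpace α] {κ : α → Measure ℝ}
    [∀ a, IsProbabilityMeasure (κ a)] (hκ : Measurable κ) :
    Measurable fun a => ProbabilityTheory.variance id (κ a) := by
  have hk : ProbabilityTheory.IsMarkovKernel (⟨κ, hκ⟩ : ProbabilityTheory.Kernel α ℝ) :=
    ⟨fun a => inferInstanceAs (IsProbabilityMeasure (κ a))⟩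
  have h := measurable_integral_id hκ
  refine Measurable.ennreal_toReal ?_
  have hf : Measurable fun q : α × ℝ => ‖q.2 - ∫ t, t ∂(κ q.1)‖ₑ ^ 2 :=
    ((measurable_snd.sub (h.comp measurable_fst)).enorm).pow_const 2
  exact hf.lintegral_kernel_prod_right' (κ := (⟨κ, hκ⟩ : ProbabilityTheory.Kernel α ℝ))

theorem measurable_sampleMean {m : ℕ} : Measurable fun y : Fin m → ℝ => sampleMean y := by
  unfold sampleMean; fun_prop

theorem measurable_sampleSD {m : ℕ} : Measurable fun y : Fin m → ℝ => sampleSD y := by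
  have := measurable_sampleMean (m := m)
  unfold sampleSD
  fun_prop

namespace Problem

variable {K : ℕ} {Θ₀ : Type u} [MeasurableSpace Θ₀]
  {Θ : Fin K → Type v} [∀ k, MeasurableSpace (Θ k)] (S : Problem K Θ₀ Θ)

theorem measurableSet_ball (n m : ℕ) (k : Fin K) (i : Fin n) :
    MeasurableSet {q : (Data n m × Θ k) × ℝ | q.2 ∈ S.ball q.1.1 k i q.1.2} := by
  have hD : Measurable fun q : (Data n m × Θ k) × ℝ => q.1.1 i :=
    (measurable_pi_apply i).comp (measurable_fst.comp measurable_fst)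
  have h1 := measurable_sampleMean.comp hD
  have h2 := measurable_sampleSD.comp hD
  have h3 : Measurable fun q : (Data n m × Θ k) × ℝ =>
      (S.model k).H ((S.model k).eta q.1.2 q.2) :=
    (S.model k).measurable_H.comp ((S.model k).measurable_eta.comp
      ((measurable_snd.comp measurable_fst).prodMk measurable_snd))
  have h4 : Measurable fun q : (Data n m × Θ k) × ℝ => S.cB * sampleSD (q.1.1 i) / √m :=
    (h2.const_mul _).div_const _
  exact (measurable_snd S.isCompact_X.measurableSet).inter
    ((measurableSet_le (h1.sub h4) h3).inter (measurableSet_le h3 (h1.add h4)))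

theorem measurable_covPrior (n m : ℕ) (k : Fin K) (i : Fin n) :
    Measurable fun q : (Data n m × Θ k) × ℝ => S.covPrior q.1.1 k i q.1.2 q.2 := by
  have h := S.measurableSet_ball n m k i
  have hv : Measurable fun q : Data n m × Θ k => volume (S.ball q.1 k i q.2) :=
    measurable_measure_prodMk_left h
  unfold covPrior
  exact Measurable.ite h (hv.inv.comp measurable_fst) measurable_const

theorem measurable_cvDensity (n m : ℕ) (k : Fin K) (i : Fin n) :
    Measurable fun q : Data n m × ℝ => S.cvDensity q.1 k i q.2 := by
  have := (S.model k).isProbabilityMeasure_prior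
  have h1 : Measurable fun r : (Data n m × ℝ) × Θ k => S.covPrior r.1.1 k i r.2 r.1.2 :=
    (S.measurable_covPrior n m k i).comp (f := fun r : (Data n m × ℝ) × Θ k =>
      ((r.1.1, r.2), r.1.2)) (by fun_prop)
  have hu : Measurable fun t : ℝ => Function.update (S.xs n) i t := by
    refine measurable_pi_iff.2 fun j => ?_
    by_cases h : j = i
    · subst h; simp only [Function.update_self]; exact measurable_id
    · simp [h]
  have h2 : Measurable fun r : (Data n m × ℝ) × Θ k =>
      (S.model k).likelihood (Function.update (S.xs n) i r.1.2) r.2 r.1.1 :=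
    ((S.model k).measurable_likelihood n m).comp (f := fun r : (Data n m × ℝ) × Θ k =>
      (Function.update (S.xs n) i r.1.2, r.2, r.1.1))
      ((hu.comp (measurable_snd.comp measurable_fst)).prodMk
        (measurable_snd.prodMk (measurable_fst.comp measurable_fst)))
  exact (h1.mul h2).lintegral_prod_right'

theorem measurable_cvPosterior (n m : ℕ) (k : Fin K) (i : Fin n) :
    Measurable fun D : Data n m => S.cvPosterior D k i := by
  have hN : Measurable fun D : Data n m => S.cvNorm D k i :=
    (S.measurable_cvDensity n m k i).lintegral_prod_right'
  have hset : MeasurableSet {D : Data n m | S.cvNorm D k i = 0 ∨ S.cvNorm D k i = ⊤} :=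
    (hN (measurableSet_singleton 0)).union (hN (measurableSet_singleton ⊤))
  unfold cvPosterior
  refine Measurable.ite hset measurable_const (Measure.measurable_of_measurable_coe _ fun s hs => ?_)
  simp only [Measure.smul_apply, withDensity_apply _ hs, smul_eq_mul]
  exact hN.inv.mul (S.measurable_cvDensity n m k i).lintegral_prod_right'

theorem measurable_T_prod (n m : ℕ) (k : Fin K) :
    Measurable fun q : Data n m × (Fin n → ℝ) => S.T q.1 k q.2 := by
  unfold T
  refine (Finset.measurable_fun_sum _ fun i _ => ?_).const_mul _
  have h := S.measurable_cvPosterior n m k i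
  exact (S.disc k).measurable_term S.cT ((measurable_pi_apply i).comp measurable_snd)
    ((measurable_integral_id h).comp measurable_fst)
    ((measurable_variance_id h).comp measurable_fst)

/-- Both the measure and the set vary with the data. The set is therefore pulled back to a section
of one measurable set in the product space, where kernel measurability applies. -/
theorem measurable_discLaw_acceptSet (n m : ℕ) (k : Fin K) :
    Measurable fun D : Data n m => S.discLaw D k (S.acceptSet D k)ᶜ := by
  have hpi : Measurable fun D : Data n m => Measure.pi fun i => S.cvPosterior D k i :=
    measurable_measure_pi fun i => S.measurable_cvPosterior n m k i
  have hk : ProbabilityTheory.IsMarkovKernel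
      (⟨_, hpi⟩ : ProbabilityTheory.Kernel (Data n m) (Fin n → ℝ)) :=
    ⟨fun D => inferInstanceAs (IsProbabilityMeasure (Measure.pi fun i => S.cvPosterior D k i))⟩
  have hT := S.measurable_T_prod n m k
  have hTx : Measurable fun D : Data n m => S.T D k (S.xs n) :=
    hT.comp (measurable_id.prodMk measurable_const)
  have hsec : ∀ D : Data n m, MeasurableSet (S.acceptSet D k)ᶜ := fun D =>
    ((measurable_id.sub_const (S.T D k (S.xs n))) measurableSet_Icc).compl
  have hset : MeasurableSet
      {q : Data n m × (Fin n → ℝ) | S.T q.1 k q.2 ∈ (S.acceptSet q.1 k)ᶜ} := by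
    have hd := hT.sub (hTx.comp measurable_fst)
    refine (MeasurableSet.inter (measurableSet_le ?_ hd) (measurableSet_le hd ?_)).compl
    · exact (((S.measurable_lo k n m).comp measurable_fst).sub_const _).sub_const _
    · exact (((S.measurable_up k n m).comp measurable_fst).sub_const _).add_const _
  have := ProbabilityTheory.Kernel.measurable_kernel_prodMk_left
    (κ := (⟨_, hpi⟩ : ProbabilityTheory.Kernel (Data n m) (Fin n → ℝ))) hset
  convert this using 2 with D
  rw [discLaw, Measure.map_apply (S.measurable_T D k) (hsec D)]
  rfl

theorem measurable_postModel (n m : ℕ) (k : Fin K) :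
    Measurable fun D : Data n m => S.postModel D k :=
  (((S.model k).measurable_marginal (S.xs n)).const_mul _).div
    (Finset.measurable_fun_sum _ fun l _ => ((S.model l).measurable_marginal (S.xs n)).const_mul _)

theorem measurable_postParam (n m : ℕ) (k : Fin K) (A : Set (Θ k)) :
    Measurable fun D : Data n m => S.postParam D k A := by
  have := (S.model k).isProbabilityMeasure_prior
  exact (((S.model k).measurable_likelihood_of (S.xs n)).lintegral_prod_right'
    (ν := (S.model k).prior.restrict A)).div ((S.model k).measurable_marginal (S.xs n))

theorem measurable_postAlt (n m : ℕ) (k : Fin K) :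
    Measurable fun D : Data n m => S.postAlt D k := by
  have h := S.measurable_postModel n m
  exact (((Finset.measurable_fun_sum _ fun l _ => h l).add
    ((h k).mul (S.measurable_postParam n m k _))).add
    (((h k).mul (S.measurable_postParam n m k _)).mul
      (S.measurable_discLaw_acceptSet n m k))).ennreal_toReal

/-! ### Elementary bounds on `postAlt` and `cFDR` -/

theorem cFDR_eq (β : ℝ) {n m : ℕ} (D : Data n m) :
    S.cFDR β D = (∑ k, ((S.decision β D k : ℕ) : ℝ) * (1 - S.postAlt D k)) /
      max (∑ k, ((S.decision β D k : ℕ) : ℝ)) 1 := by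
  simp [cFDR, decisionProb]

theorem decision_cast (β : ℝ) {n m : ℕ} (D : Data n m) (k : Fin K) :
    ((S.decision β D k : ℕ) : ℝ) = Set.indicator {D : Data n m | β < S.postAlt D k} 1 D := by
  by_cases h : β < S.postAlt D k <;> simp [decision, h]

theorem measurable_cFDR (β : ℝ) (n m : ℕ) : Measurable fun D : Data n m => S.cFDR β D := by
  have hd : ∀ k, Measurable fun D : Data n m => ((S.decision β D k : ℕ) : ℝ) := fun k => by
    simp only [decision_cast]
    exact measurable_one.indicator (measurableSet_lt measurable_const (S.measurable_postAlt n m k))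
  simp only [cFDR_eq]
  exact (Finset.measurable_fun_sum _ fun k _ =>
    (hd k).mul ((S.measurable_postAlt n m k).const_sub 1)).div
    ((Finset.measurable_fun_sum _ fun k _ => hd k).max measurable_const)

/-- The pieces recombine into a sum of posterior model probabilities. The bound also makes the
`toReal` in `postAlt` lossless. -/
theorem postAlt_arg_le_one {n m : ℕ} (D : Data n m) (k : Fin K) :
    (∑ l ∈ Finset.univ.erase k, S.postModel D l) +
      S.postModel D k * S.postParam D k (S.region k)ᶜ +
      S.postModel D k * S.postParam D k (S.region k) * S.discLaw D k (S.acceptSet D k)ᶜ ≤ 1 := by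
  calc _ ≤ (∑ l ∈ Finset.univ.erase k, S.postModel D l) +
      S.postModel D k * S.postParam D k (S.region k)ᶜ +
      S.postModel D k * S.postParam D k (S.region k) := by
        exact add_le_add le_rfl (mul_le_of_le_one_right' prob_le_one)
    _ = (∑ l ∈ Finset.univ.erase k, S.postModel D l) + S.postModel D k *
        (S.postParam D k (S.region k)ᶜ + S.postParam D k (S.region k)) := by ring
    _ ≤ (∑ l ∈ Finset.univ.erase k, S.postModel D l) + S.postModel D k := by
        gcongr
        exact mul_le_of_le_one_right' (postParam_add_compl_le D k)
    _ ≤ 1 := by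
        rw [Finset.sum_erase_add _ _ (Finset.mem_univ k)]
        exact sum_postModel_le_one D

theorem postAlt_nonneg {n m : ℕ} (D : Data n m) (k : Fin K) : 0 ≤ S.postAlt D k :=
  ENNReal.toReal_nonneg

theorem postAlt_le_one {n m : ℕ} (D : Data n m) (k : Fin K) : S.postAlt D k ≤ 1 := by
  rw [← ENNReal.toReal_one]
  exact ENNReal.toReal_mono ENNReal.one_ne_top (S.postAlt_arg_le_one D k)

/-- The event that model `l` holds is part of the alternative for `k`. With `l` the best model this
drives `postAlt` to 1; with `k` the best model it shows positivity. -/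
theorem postModel_le_postAlt {n m : ℕ} (D : Data n m) {k l : Fin K} (h : l ≠ k) :
    (S.postModel D l).toReal ≤ S.postAlt D k := by
  refine ENNReal.toReal_mono (ne_top_of_le_ne_top ENNReal.one_ne_top (S.postAlt_arg_le_one D k)) ?_
  rw [add_assoc]
  exact (Finset.single_le_sum (f := fun l => S.postModel D l) (fun _ _ => zero_le)
    (Finset.mem_erase.2 ⟨h, Finset.mem_univ l⟩)).trans le_self_add

theorem postModel_le_one {n m : ℕ} (D : Data n m) (k : Fin K) : S.postModel D k ≤ 1 :=
  (Finset.single_le_sum (f := fun l => S.postModel D l) (fun _ _ => zero_le)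
    (Finset.mem_univ k)).trans (sum_postModel_le_one D)

theorem postAlt_le {n m : ℕ} (D : Data n m) (k : Fin K) :
    ENNReal.ofReal (S.postAlt D k) ≤ (∑ l ∈ Finset.univ.erase k, S.postModel D l) +
      S.postParam D k (S.region k)ᶜ + S.discLaw D k (S.acceptSet D k)ᶜ := by
  refine ENNReal.ofReal_toReal_le.trans ?_
  have h := le_add_self.trans (postParam_add_compl_le (S := S) D k)
  gcongr
  · exact mul_le_of_le_one_left' (S.postModel_le_one D k)
  · exact mul_le_of_le_one_left' (mul_le_one' (S.postModel_le_one D k) h)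

theorem cFDR_nonneg (β : ℝ) {n m : ℕ} (D : Data n m) : 0 ≤ S.cFDR β D := by
  rw [cFDR_eq]
  exact div_nonneg (Finset.sum_nonneg fun k _ => mul_nonneg (Nat.cast_nonneg _)
    (sub_nonneg.2 (S.postAlt_le_one D k))) (zero_le_one.trans (le_max_right _ _))

theorem cFDR_le_one (β : ℝ) {n m : ℕ} (D : Data n m) : S.cFDR β D ≤ 1 := by
  rw [cFDR_eq, div_le_one (zero_lt_one.trans_le (le_max_right _ _))]
  refine le_max_of_le_left (Finset.sum_le_sum fun k _ => ?_)
  exact mul_le_of_le_one_right (Nat.cast_nonneg _) (by linarith [S.postAlt_nonneg D k])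

end Problem

/-! ### Iterated limits and deterministic thresholds -/

/-- Bounded convergence for iterated limits. -/
theorem iterLim_integral {Ω : Type*} [MeasurableSpace Ω] {P : Measure Ω} [IsProbabilityMeasure P]
    {c : ℕ → ℕ → Ω → ℝ} (hc : ∀ n m, Measurable (c n m)) (hc0 : ∀ n m ω, 0 ≤ c n m ω)
    (hc1 : ∀ n m ω, c n m ω ≤ 1) {L : ℝ} (h : ∀ᵐ ω ∂P, IterLim (fun n m => c n m ω) L) :
    IterLim (fun n m => ∫ ω, c n m ω ∂P) L := by
  set F : ℕ → ℕ → Ω → ℝ≥0∞ := fun m n ω => ‖c n m ω - L‖ₑ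
  have hF : ∀ m n, Measurable (F m n) := fun m n => ((hc n m).sub_const L).enorm
  set M : ℝ≥0∞ := ENNReal.ofReal (1 + |L|)
  have hFM : ∀ m n ω, F m n ω ≤ M := fun m n ω => by
    simp only [F, M, Real.enorm_eq_ofReal_abs]
    refine ENNReal.ofReal_le_ofReal ((abs_sub _ _).trans ?_)
    rw [abs_of_nonneg (hc0 n m ω)]
    linarith [hc1 n m ω]
  have hM : ∫⁻ _, M ∂P ≠ ⊤ := by simp [M]
  -- The upper limit in n leaves a sequence in m alone: dominated convergence handles m, and reverse
  -- Fatou brings the integral inside the upper limit in n.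
  set g : ℕ → Ω → ℝ≥0∞ := fun m ω => limsup (fun n => F m n ω) atTop
  have hg : ∀ m, Measurable (g m) := fun m => Measurable.limsup (hF m)
  have hglim : Tendsto (fun m => ∫⁻ ω, g m ω ∂P) atTop (𝓝 0) := by
    rw [← lintegral_zero (μ := P)]
    refine tendsto_lintegral_of_dominated_convergence (fun _ => M) hg
      (fun m => ae_of_all _ fun ω => ?_) hM ?_
    · exact limsup_le_of_le ⟨0, fun _ _ => zero_le⟩ (Eventually.of_forall fun n => hFM m n ω)
    · filter_upwards [h] with ω hω
      refine ENNReal.tendsto_nhds_zero.2 fun ε hε => ?_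
      obtain ⟨r, hr0, hrε⟩ := ENNReal.lt_iff_exists_nnreal_btwn.1 hε
      filter_upwards [hω r (by exact_mod_cast hr0)] with m hm
      refine limsup_le_of_le ⟨0, fun _ _ => zero_le⟩ ?_
      filter_upwards [hm] with n hn
      refine le_trans ?_ hrε.le
      rw [← ENNReal.ofReal_coe_nnreal]
      simp only [F, Real.enorm_eq_ofReal_abs]
      exact ENNReal.ofReal_le_ofReal hn.le
  intro δ hδ
  filter_upwards [hglim.eventually_lt_const (ENNReal.ofReal_pos.2 hδ)] with m hm
  have hlim : limsup (fun n => ∫⁻ ω, F m n ω ∂P) atTop < ENNReal.ofReal δ :=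
    (limsup_lintegral_le (fun _ => M) (hF m) (fun n => ae_of_all _ (hFM m n)) hM).trans_lt hm
  filter_upwards [eventually_lt_of_limsup_lt hlim] with n hn
  have hint : Integrable (c n m) P := Integrable.of_bound (hc n m).aestronglyMeasurable 1
    (ae_of_all _ fun ω => by rw [Real.norm_of_nonneg (hc0 n m ω)]; exact hc1 n m ω)
  have heq : ∫ ω, c n m ω ∂P - L = ∫ ω, (c n m ω - L) ∂P := by
    rw [integral_sub hint (integrable_const L)]; simp
  rw [heq, ← ENNReal.ofReal_lt_ofReal_iff hδ, ← Real.enorm_eq_ofReal_abs]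
  exact (enorm_integral_le_lintegral_enorm _).trans_lt hn

/-- A threshold below which a nonnegative random variable falls only if it vanishes, up to small
probability. -/
theorem exists_threshold {Ω : Type*} [MeasurableSpace Ω] {P : Measure Ω} [IsFiniteMeasure P]
    {v : Ω → ℝ} (hv : Measurable v) {b : ℝ} (hb : 0 < b) {η : ℝ≥0∞} (hη : 0 < η) :
    ∃ β : ℝ, 0 < β ∧ β ≤ b ∧ P {ω | 0 < v ω ∧ v ω ≤ β} < η := by
  set s : ℕ → Set Ω := fun j => {ω | 0 < v ω ∧ v ω ≤ b / ((j : ℝ) + 1)}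
  have hs : ∀ j, MeasurableSet (s j) := fun j =>
    (measurableSet_lt measurable_const hv).inter (measurableSet_le hv measurable_const)
  have hanti : Antitone s := fun i j hij ω hω => by
    refine ⟨hω.1, hω.2.trans ?_⟩
    have : (i : ℝ) ≤ j := Nat.cast_le.2 hij
    gcongr
  have hlim : Tendsto (fun j : ℕ => b / ((j : ℝ) + 1)) atTop (𝓝 0) :=
    tendsto_const_nhds.div_atTop (tendsto_atTop_add_const_right _ _ tendsto_natCast_atTop_atTop)
  have hempty : ⋂ j, s j = ∅ := by
    refine Set.eq_empty_of_forall_notMem fun ω hω => ?_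
    rw [Set.mem_iInter] at hω
    exact absurd (ge_of_tendsto' hlim fun j => (hω j).2) (not_le.2 (hω 0).1)
  have ht := tendsto_measure_iInter_atTop (μ := P) (fun j => (hs j).nullMeasurableSet) hanti
    ⟨0, measure_ne_top _ _⟩
  rw [hempty, measure_empty] at ht
  obtain ⟨j, hj⟩ := (ht.eventually_lt_const hη).exists
  refine ⟨b / ((j : ℝ) + 1), by positivity, div_le_self hb.le ?_, hj⟩
  linarith [Nat.cast_nonneg (α := ℝ) j]

/-! ### The two regimes of the false discovery rate -/

namespace Problem

variable {K : ℕ} {Θ₀ : Type u} [MeasurableSpace Θ₀]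
  {Θ : Fin K → Type v} [∀ k, MeasurableSpace (Θ k)] {S : Problem K Θ₀ Θ}

theorem decision_eq_one_iff {β : ℝ} {n m : ℕ} {D : Data n m} {k : Fin K} :
    S.decision β D k = 1 ↔ β < S.postAlt D k := by
  simp [decision]

theorem decision_eq_zero_iff {β : ℝ} {n m : ℕ} {D : Data n m} {k : Fin K} :
    S.decision β D k = 0 ↔ ¬ β < S.postAlt D k := by
  simp [decision]

theorem sum_erase_one_sub_postAlt_le {n m : ℕ} {D : Data n m} {best : Fin K} {δ : ℝ}
    (h : ∀ k, k ≠ best → 1 - δ < S.postAlt D k) :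
    ∑ k ∈ Finset.univ.erase best, (1 - S.postAlt D k) ≤ (K - 1) * δ := by
  calc _ ≤ ∑ k ∈ Finset.univ.erase best, δ := Finset.sum_le_sum fun k hk => by
        linarith [h k (Finset.ne_of_mem_erase hk)]
    _ = _ := by
        have : 1 ≤ K := by have := best.isLt; omega
        simp [Finset.card_erase_of_mem, Nat.cast_sub this]

/-- The false discovery rate when the null hypothesis of the best model is not rejected. -/
theorem cFDR_of_decision_eq_zero {β : ℝ} {n m : ℕ} {D : Data n m} {best : Fin K} {δ : ℝ}
    (h : ∀ k, k ≠ best → 1 - δ < S.postAlt D k) (hδ : 0 < δ) (hd : S.decision β D best = 0) :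
    S.cFDR β D ≤ K * δ := by
  rw [cFDR_eq]
  have hterm : ∀ k, 0 ≤ ((S.decision β D k : ℕ) : ℝ) * (1 - S.postAlt D k) := fun k =>
    mul_nonneg (Nat.cast_nonneg _) (sub_nonneg.2 (S.postAlt_le_one D k))
  refine (div_le_self (Finset.sum_nonneg fun k _ => hterm k) (le_max_right _ _)).trans ?_
  rw [← Finset.add_sum_erase _ _ (Finset.mem_univ best), hd]
  have h1 : ∑ k ∈ Finset.univ.erase best, ((S.decision β D k : ℕ) : ℝ) * (1 - S.postAlt D k) ≤
      ∑ k ∈ Finset.univ.erase best, (1 - S.postAlt D k) := Finset.sum_le_sum fun k _ => by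
    refine mul_le_of_le_one_left (sub_nonneg.2 (S.postAlt_le_one D k)) ?_
    exact_mod_cast Nat.lt_succ_iff.1 (S.decision β D k).isLt
  have h2 := sum_erase_one_sub_postAlt_le h
  simp only [Fin.val_zero, Nat.cast_zero, zero_mul, zero_add]
  linarith

/-- The false discovery rate when the null hypothesis of the best model is rejected. -/
theorem cFDR_of_decision_eq_one {β : ℝ} {n m : ℕ} {D : Data n m} {best : Fin K} {δ : ℝ}
    (h : ∀ k, k ≠ best → 1 - δ < S.postAlt D k) (hb : S.postAlt D best < δ) (hδ : δ ≤ 1 / 2)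
    (hd : S.decision β D best = 1) : |S.cFDR β D - 1 / K| ≤ K * δ := by
  have hβ : β < S.postAlt D best := decision_eq_one_iff.1 hd
  have hδ0 : 0 < δ := (S.postAlt_nonneg D best).trans_lt hb
  -- The chain β < `postAlt` of `best` < δ ≤ 1 - δ < `postAlt` of `k` forces every rejection; this
  -- is where δ ≤ 1/2 enters.
  have hall : ∀ k, S.decision β D k = 1 := fun k => by
    by_cases hk : k = best
    · rw [hk, hd]
    · exact decision_eq_one_iff.2 (by linarith [h k hk])
  have hK : (1 : ℝ) ≤ K := by
    have : 1 ≤ K := by have := best.isLt; omega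
    exact_mod_cast this
  have h2 := sum_erase_one_sub_postAlt_le h
  have h3 : 0 ≤ ∑ k ∈ Finset.univ.erase best, (1 - S.postAlt D k) :=
    Finset.sum_nonneg fun k _ => sub_nonneg.2 (S.postAlt_le_one D k)
  have heq : S.cFDR β D - 1 / K = (-S.postAlt D best +
      ∑ k ∈ Finset.univ.erase best, (1 - S.postAlt D k)) / K := by
    rw [cFDR_eq]
    simp only [hall, Fin.val_one, Nat.cast_one, one_mul, Finset.sum_const, Finset.card_univ,
      Fintype.card_fin, nsmul_eq_mul, mul_one, max_eq_left hK]
    rw [← Finset.add_sum_erase _ _ (Finset.mem_univ best)]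
    ring
  have hnum : |-S.postAlt D best + ∑ k ∈ Finset.univ.erase best, (1 - S.postAlt D k)| ≤ K * δ := by
    rw [abs_le]
    have := S.postAlt_nonneg D best
    constructor <;> nlinarith
  rw [heq, abs_div, abs_of_pos (zero_lt_one.trans_le hK)]
  exact (div_le_self (abs_nonneg _) hK).trans hnum

variable {Ω : Type w} {Y : ℕ → ℕ → Ω → ℝ} {best : Fin K}

/-- Asymptotics of the procedure along a realisation. -/
theorem iterLim_of_decision_eq_one {β : ℕ → ℕ → ℝ} (hβ : ∀ n m, 0 < β n m) {ω : Ω}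
    (hω : ∀ δ > 0, ∀ᶠ m in atTop, ∀ᶠ n in atTop, S.postAlt (block Y n m ω) best < δ ∧
      ∀ k, k ≠ best → 1 - δ < S.postAlt (block Y n m ω) k)
    (hd : ∀ᶠ m in atTop, ∀ᶠ n in atTop, S.decision (β n m) (block Y n m ω) best = 1) :
    IterLim β 0 ∧ IterLim (fun n m => S.cFDR (β n m) (block Y n m ω)) (1 / K) := by
  have hK : (0 : ℝ) < K := Nat.cast_pos.2 best.pos
  constructor
  · intro δ hδ
    filter_upwards [hω δ hδ, hd] with m h1 h2
    filter_upwards [h1, h2] with n h3 h4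
    rw [sub_zero, abs_of_pos (hβ n m)]
    exact (decision_eq_one_iff.1 h4).trans h3.1
  · intro δ hδ
    filter_upwards [hω (min (1 / 2) (δ / (2 * K))) (by positivity), hd] with m h1 h2
    filter_upwards [h1, h2] with n h3 h4
    refine (cFDR_of_decision_eq_one h3.2 h3.1 (min_le_left _ _) h4).trans_lt ?_
    calc (K : ℝ) * min (1 / 2) (δ / (2 * K)) ≤ K * (δ / (2 * K)) := by
          gcongr; exact min_le_right _ _
      _ = δ / 2 := by field_simp
      _ < δ := half_lt_self hδ

theorem iterLim_of_decision_eq_zero {β : ℕ → ℕ → ℝ} {ω : Ω}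
    (hω : ∀ δ > 0, ∀ᶠ m in atTop, ∀ᶠ n in atTop, S.postAlt (block Y n m ω) best < δ ∧
      ∀ k, k ≠ best → 1 - δ < S.postAlt (block Y n m ω) k)
    (hd : ∀ᶠ m in atTop, ∀ᶠ n in atTop, S.decision (β n m) (block Y n m ω) best = 0) :
    IterLim (fun n m => S.cFDR (β n m) (block Y n m ω)) 0 := by
  have hK : (0 : ℝ) < K := Nat.cast_pos.2 best.pos
  intro δ hδ
  filter_upwards [hω (δ / (2 * K)) (by positivity), hd] with m h1 h2
  filter_upwards [h1, h2] with n h3 h4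
  rw [sub_zero, abs_of_nonneg (S.cFDR_nonneg _ _)]
  refine (cFDR_of_decision_eq_zero h3.2 (by positivity) h4).trans_lt ?_
  calc (K : ℝ) * (δ / (2 * K)) = δ / 2 := by field_simp
    _ < δ := half_lt_self hδ

/-- Whichever decision is taken at a large (n, m), the rate is close to 0 or to 1/K. A limit at
distance 2δ from both is refuted at a single such pair, so the decisions need not stabilise. -/
theorem eq_of_iterLim_cFDR {β : ℕ → ℕ → ℝ} {ω : Ω} {L : ℝ}
    (hω : ∀ δ > 0, ∀ᶠ m in atTop, ∀ᶠ n in atTop, S.postAlt (block Y n m ω) best < δ ∧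
      ∀ k, k ≠ best → 1 - δ < S.postAlt (block Y n m ω) k)
    (hL : IterLim (fun n m => S.cFDR (β n m) (block Y n m ω)) L) :
    L = 0 ∨ L = 1 / (K : ℝ) := by
  by_contra! hne
  have hK : (0 : ℝ) < K := Nat.cast_pos.2 best.pos
  have h0 : 0 < |L| := abs_pos.2 hne.1
  have h1 : 0 < |L - 1 / K| := abs_pos.2 (sub_ne_zero.2 hne.2)
  set δ := min |L| |L - 1 / K| / 2
  have hδ : 0 < δ := by positivity
  have hδ0 : 2 * δ ≤ |L| := by simp only [δ]; linarith [min_le_left |L| |L - 1 / K|]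
  have hδ1 : 2 * δ ≤ |L - 1 / K| := by simp only [δ]; linarith [min_le_right |L| |L - 1 / K|]
  obtain ⟨m, h2, h3⟩ := ((hω (min (1 / 2) (δ / K)) (by positivity)).and (hL δ hδ)).exists
  obtain ⟨n, h4, h5⟩ := (h2.and h3).exists
  have hle : (K : ℝ) * min (1 / 2) (δ / K) ≤ δ := by
    calc (K : ℝ) * min (1 / 2) (δ / K) ≤ K * (δ / K) := by gcongr; exact min_le_right _ _
      _ = δ := by field_simp
  rw [abs_sub_comm] at h5
  by_cases hd : β n m < S.postAlt (block Y n m ω) best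
  · have h6 := (cFDR_of_decision_eq_one h4.2 h4.1 (min_le_left _ _)
      (decision_eq_one_iff.2 hd)).trans hle
    linarith [abs_sub_le L (S.cFDR (β n m) (block Y n m ω)) (1 / K)]
  · have h6 := (cFDR_of_decision_eq_zero h4.2 (by positivity)
      (decision_eq_zero_iff.2 hd)).trans hle
    have h7 := abs_sub_le L (S.cFDR (β n m) (block Y n m ω)) 0
    rw [sub_zero, sub_zero, abs_of_nonneg (S.cFDR_nonneg (β n m) (block Y n m ω))] at h7
    linarith

variable [MeasurableSpace Ω] {P : Measure Ω} [IsProbabilityMeasure P] {α : ℝ}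

/-- The posterior probability of the alternative vanishes for the best model and tends to one for
all other models. -/
theorem ae_postAlt_asymptotics (hY : S.IsGenerated P Y) (hS : ∀ k, ∀ m > 1, S.Shalizi P Y k m)
    (hbest : ∀ m > 1, ∀ k, k ≠ best → S.klInf best m Set.univ < S.klInf k m Set.univ)
    (hregion : ∀ k, ∀ m > 1, S.klInf k m Set.univ < S.klInf k m (S.region k)ᶜ)
    (hα : α < 1) (hcred : S.IsCredible α) (ha : S.IsDiscrepancyLimit P Y) :
    ∀ᵐ ω ∂P, ∀ δ > 0, ∀ᶠ m in atTop, ∀ᶠ n in atTop,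
      S.postAlt (block Y n m ω) best < δ ∧
        ∀ k, k ≠ best → 1 - δ < S.postAlt (block Y n m ω) k := by
  obtain ⟨C, hC, hacc⟩ := S.exists_discLaw_acceptSet_le hα hcred
  have h1 : ∀ᵐ ω ∂P, ∀ m, m > 1 →
      (Tendsto (fun n => ∑ l ∈ Finset.univ.erase best, S.postModel (block Y n m ω) l)
        atTop (𝓝 0) ∧ Tendsto (fun n => S.postModel (block Y n m ω) best) atTop (𝓝 1)) ∧
      Tendsto (fun n => S.postParam (block Y n m ω) best (S.region best)ᶜ) atTop (𝓝 0) := by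
    refine ae_all_iff.2 fun m => ?_
    by_cases hm : m > 1
    · filter_upwards [tendsto_postModel hY (fun k => hS k m hm) (hbest m hm),
        tendsto_postParam hY (hS best m hm) (hregion best m hm)] with ω h2 h3 _ using ⟨h2, h3⟩
    · exact ae_of_all _ fun _ h => absurd h hm
  filter_upwards [h1, ha best] with ω hω haω δ hδ
  filter_upwards [haω (S.ε / 2) (half_pos S.ε_pos), eventually_gt_atTop 1] with m hm hm1
  obtain ⟨⟨h2, h3⟩, h4⟩ := hω m hm1
  have hlim : Tendsto (fun n : ℕ => ENNReal.ofReal (C / n)) atTop (𝓝 0) := by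
    simpa using ENNReal.tendsto_ofReal
      ((tendsto_const_nhds (x := C)).div_atTop tendsto_natCast_atTop_atTop)
  have hsum := (h2.add h4).add hlim
  simp only [add_zero] at hsum
  have h5 : Tendsto (fun n => (S.postModel (block Y n m ω) best).toReal) atTop (𝓝 1) :=
    (ENNReal.tendsto_toReal ENNReal.one_ne_top).comp h3
  filter_upwards [hm, hacc, hsum.eventually_lt_const (ENNReal.ofReal_pos.2 hδ),
    h5.eventually_const_lt (sub_lt_self 1 hδ)] with n hn hn1 hn2 hn3
  refine ⟨?_, fun k hk => hn3.trans_le (S.postModel_le_postAlt _ hk.symm)⟩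
  rw [← ENNReal.ofReal_lt_ofReal_iff hδ]
  refine (S.postAlt_le _ best).trans_lt (lt_of_le_of_lt ?_ hn2)
  gcongr
  exact hn1 m hm1 _ best hn

/-- With K > 1 there is a competitor, and its posterior probability is positive once its evidence is
nonzero. -/
theorem ae_postAlt_pos (hK : 1 < K) (hY : S.IsGenerated P Y)
    (hS : ∀ k, ∀ m > 1, S.Shalizi P Y k m) :
    ∀ᵐ ω ∂P, ∀ m > 1, ∀ᶠ n in atTop, 0 < S.postAlt (block Y n m ω) best := by
  have : Nontrivial (Fin K) := Fin.nontrivial_iff_two_le.2 hK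
  obtain ⟨k, hk⟩ := exists_ne best
  refine ae_all_iff.2 fun m => ?_
  by_cases hm : m > 1
  · filter_upwards [(hS k m hm).eventually_evidence_ne_zero hY, hY.ae_regular] with ω h1 h2 _
    filter_upwards [h1] with n hn
    refine lt_of_lt_of_le (ENNReal.toReal_pos ((h2 n m).postModel_pos hn).ne' ?_)
      (S.postModel_le_postAlt _ hk)
    exact ne_top_of_le_ne_top ENNReal.one_ne_top (S.postModel_le_one _ k)
  · exact ae_of_all _ fun _ h => absurd h hm

theorem iterLim_pBFDR (hY : S.IsGenerated P Y) (β : ℕ → ℕ → ℝ) {L : ℝ}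
    (h : ∀ᵐ ω ∂P, IterLim (fun n m => S.cFDR (β n m) (block Y n m ω)) L) :
    IterLim (fun n m => S.pBFDR (β n m) n m) L := by
  have heq : ∀ n m, S.pBFDR (β n m) n m = ∫ ω, S.cFDR (β n m) (block Y n m ω) ∂P := fun n m => by
    rw [pBFDR, ← hY.law, integral_map (hY.measurable_block n m).aemeasurable
      (S.measurable_cFDR _ n m).aestronglyMeasurable]
  simp only [heq]
  exact iterLim_integral
    (fun n m => (S.measurable_cFDR (β n m) n m).comp (hY.measurable_block n m))
    (fun n m ω => S.cFDR_nonneg _ _) (fun n m ω => S.cFDR_le_one _ _) h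

/-- There is a deterministic threshold, tending to zero, below the posterior probability of the
alternative for the best model. -/
theorem exists_penalty (hK : 1 < K) (hY : S.IsGenerated P Y)
    (hS : ∀ k, ∀ m > 1, S.Shalizi P Y k m) (best : Fin K) :
    ∃ β : ℕ → ℕ → ℝ, (∀ n m, 0 < β n m ∧ β n m < 1) ∧
      Tendsto (fun q : ℕ × ℕ => β q.1 q.2) (atTop ×ˢ atTop) (𝓝 0) ∧
      ∀ᵐ ω ∂P, ∀ᶠ m in atTop, ∀ᶠ n in atTop, S.decision (β n m) (block Y n m ω) best = 1 := by
  -- The cap 1/(n+2) is below 1 and tends to 0 uniformly in m, giving the joint limit; the error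
  -- (1/2)^n is summable in n for each m, as Borel–Cantelli requires.
  have hex : ∀ n m : ℕ, ∃ β : ℝ, 0 < β ∧ β ≤ 1 / ((n : ℝ) + 2) ∧
      P {ω | 0 < S.postAlt (block Y n m ω) best ∧ S.postAlt (block Y n m ω) best ≤ β} <
        ENNReal.ofReal ((1 / 2) ^ n) := fun n m =>
    exists_threshold ((S.measurable_postAlt n m best).comp (hY.measurable_block n m))
      (by positivity) (by positivity)
  choose β hβ0 hβ1 hβ2 using hex
  refine ⟨β, fun n m => ⟨hβ0 n m, (hβ1 n m).trans_lt ?_⟩, ?_, ?_⟩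
  · rw [div_lt_one (by positivity)]
    linarith [Nat.cast_nonneg (α := ℝ) n]
  · have hlim : Tendsto (fun n : ℕ => 1 / ((n : ℝ) + 2)) atTop (𝓝 0) :=
      tendsto_const_nhds.div_atTop (tendsto_atTop_add_const_right _ _ tendsto_natCast_atTop_atTop)
    exact tendsto_of_tendsto_of_tendsto_of_le_of_le tendsto_const_nhds
      (hlim.comp tendsto_fst) (fun q => (hβ0 q.1 q.2).le) fun q => hβ1 q.1 q.2
  · have hbc : ∀ᵐ ω ∂P, ∀ m, ∀ᶠ n in atTop, ω ∉ {ω | 0 < S.postAlt (block Y n m ω) best ∧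
        S.postAlt (block Y n m ω) best ≤ β n m} := ae_all_iff.2 fun m =>
      ae_eventually_notMem (ne_top_of_le_ne_top summable_geometric_two.tsum_ofReal_ne_top
        (ENNReal.tsum_le_tsum fun n => (hβ2 n m).le))
    filter_upwards [hbc, ae_postAlt_pos (best := best) hK hY hS] with ω h1 h2
    filter_upwards [eventually_gt_atTop 1] with m hm
    filter_upwards [h1 m, h2 m hm] with n h3 h4
    exact decision_eq_one_iff.2 (not_le.1 fun h => h3 ⟨h4, h⟩)

end Problem

end InverseTest

/-! ### Assembly of the theorem -/

theorem mainTheorem6 {K : ℕ} (hK : 1 < K) {Θ₀ : Type u} [MeasurableSpace Θ₀]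
    {Θ : Fin K → Type v} [∀ k, MeasurableSpace (Θ k)]
    (S : InverseTest.Problem K Θ₀ Θ)
    {Ω : Type w} [MeasurableSpace Ω] (P : Measure Ω) [IsProbabilityMeasure P]
    (Y : ℕ → ℕ → Ω → ℝ) (hY : S.IsGenerated P Y)
    (hS : ∀ k, ∀ m > 1, S.Shalizi P Y k m)
    (best : Fin K)
    (hbest : ∀ m > 1, ∀ k, k ≠ best → S.klInf best m Set.univ < S.klInf k m Set.univ)
    (hregion : ∀ k, ∀ m > 1, S.klInf k m Set.univ < S.klInf k m (S.region k)ᶜ)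
    (α : ℝ) (hα : 0 < α ∧ α < 1) (hcred : S.IsCredible α)
    (ha : S.IsDiscrepancyLimit P Y) :
    -- level `1 / K` is attained along some `β → 0`
    (∃ β : ℕ → ℕ → ℝ, (∀ n m, 0 < β n m ∧ β n m < 1) ∧
      Tendsto (fun q : ℕ × ℕ => β q.1 q.2) (atTop ×ˢ atTop) (𝓝 0) ∧
      (∀ᵐ ω ∂P, InverseTest.IterLim
        (fun n m => S.cFDR (β n m) (InverseTest.block Y n m ω)) (1 / (K : ℝ))) ∧
      InverseTest.IterLim (fun n m => S.pBFDR (β n m) n m) (1 / (K : ℝ))) ∧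
    -- no other nonzero level is possible
    (∀ β : ℕ → ℕ → ℝ, (∀ n m, 0 < β n m ∧ β n m < 1) →
      -- if the null hypothesis of the best model is eventually rejected
      ((∀ᵐ ω ∂P, ∀ᶠ m in atTop, ∀ᶠ n in atTop,
          S.decision (β n m) (InverseTest.block Y n m ω) best = 1) →
        InverseTest.IterLim β 0 ∧
        (∀ᵐ ω ∂P, InverseTest.IterLim
          (fun n m => S.cFDR (β n m) (InverseTest.block Y n m ω)) (1 / (K : ℝ))) ∧
        InverseTest.IterLim (fun n m => S.pBFDR (β n m) n m) (1 / (K : ℝ))) ∧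
      -- if the null hypothesis of the best model is eventually not rejected
      ((∀ᵐ ω ∂P, ∀ᶠ m in atTop, ∀ᶠ n in atTop,
          S.decision (β n m) (InverseTest.block Y n m ω) best = 0) →
        (∀ᵐ ω ∂P, InverseTest.IterLim
          (fun n m => S.cFDR (β n m) (InverseTest.block Y n m ω)) 0) ∧
        InverseTest.IterLim (fun n m => S.pBFDR (β n m) n m) 0) ∧
      -- the only possible limits
      (∀ L : ℝ, (∀ᵐ ω ∂P, InverseTest.IterLim
          (fun n m => S.cFDR (β n m) (InverseTest.block Y n m ω)) L) →
        (L = 0 ∨ L = 1 / (K : ℝ)) ∧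
        InverseTest.IterLim (fun n m => S.pBFDR (β n m) n m) L)) := by
  have hasymp := InverseTest.Problem.ae_postAlt_asymptotics hY hS hbest hregion hα.2 hcred ha
  have hone : ∀ β : ℕ → ℕ → ℝ, (∀ n m, 0 < β n m ∧ β n m < 1) →
      (∀ᵐ ω ∂P, ∀ᶠ m in atTop, ∀ᶠ n in atTop,
        S.decision (β n m) (InverseTest.block Y n m ω) best = 1) →
      InverseTest.IterLim β 0 ∧
      (∀ᵐ ω ∂P, InverseTest.IterLim
        (fun n m => S.cFDR (β n m) (InverseTest.block Y n m ω)) (1 / (K : ℝ))) ∧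
      InverseTest.IterLim (fun n m => S.pBFDR (β n m) n m) (1 / (K : ℝ)) := by
    intro β hβ hd
    have h := hasymp.and hd
    have hlim : ∀ᵐ ω ∂P, InverseTest.IterLim β 0 ∧ InverseTest.IterLim
        (fun n m => S.cFDR (β n m) (InverseTest.block Y n m ω)) (1 / (K : ℝ)) := h.mono
      fun ω hω => InverseTest.Problem.iterLim_of_decision_eq_one (fun n m => (hβ n m).1) hω.1 hω.2
    -- The penalties are nonrandom, so one good realisation determines their limit.
    obtain ⟨ω, hω⟩ := hlim.exists
    have hc := hlim.mono fun ω hω => hω.2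
    exact ⟨hω.1, hc, InverseTest.Problem.iterLim_pBFDR hY β hc⟩
  refine ⟨?_, fun β hβ => ⟨hone β hβ, fun hd => ?_, fun L hL => ⟨?_, ?_⟩⟩⟩
  · obtain ⟨β, hβ, hβ0, hd⟩ := InverseTest.Problem.exists_penalty hK hY hS best
    exact ⟨β, hβ, hβ0, (hone β hβ hd).2⟩
  · have hc := (hasymp.and hd).mono fun ω hω =>
      InverseTest.Problem.iterLim_of_decision_eq_zero hω.1 hω.2
    exact ⟨hc, InverseTest.Problem.iterLim_pBFDR hY β hc⟩
  · obtain ⟨ω, h1, h2⟩ := (hasymp.and hL).exists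
    exact InverseTest.Problem.eq_of_iterLim_cFDR h1 h2
  · exact InverseTest.Problem.iterLim_pBFDR hY β hL
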